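/- Let $K$ be a field of characteristic different from $2$, let $g\ge 3$ be an odd integer, and let $f=x^{2g+2}+a_{2g+1}x^{2g+1}+\cdots+a_0\in K[x]$ be a monic separable polynomial of degree $2g+2$. Let $C$ be the hyperelliptic curve of genus $g$ over $K$ with affine model $y^2=f(x)$ (the regular projective curve with function field $K(x)[y]/(y^2-f)$), and let $J$ be its Jacobian. Since $C$ has two $K$-rational points at infinity, $J(K)$ is the group of $K$-rational divisors of degree $0$ on $C$ modulo principal divisors. Then every element of order $2$ in $J(K)$ is the class of a $K$-rational divisor $D$ of degree $0$ on $C$ such that at least one of the following holds: (i) $2D=\operatorname{div}(h)$ for some $h\in K[x]$ of even degree $\le g-1$ with $h\mid f$; (ii) $2D=\operatorname{div}(y-h_1)$ for some $h_1\in K[x]$ that is monic of degree $g+1$ and whose coefficient of $x^g$ is $\tfrac12 a_{2g+1}$, such that $f=h_1^2-a\,h_2^2$ for some $a\in K^*$ and some $h_2\in K[x]$ of degree $\le g$. -/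

import Mathlib

open Polynomial

noncomputable section

/-! ### Divisors and degree zero classes of a curve with function field `F` over `K` -/

/-- A closed point of the regular projective curve over `K` with function field `F` (a place of
`F / K`): a discrete valuation ring of `F` that contains `K`. -/
structure CurvePoint (K F : Type*) [Field K] [Field F] [Algebra K F] where
  /-- The local ring at the point, as a subring of the function field. -/
  localRing : ValuationSubring F
  algebraMap_mem : ∀ c : K, algebraMap K F c ∈ localRing
  isDVR : IsDiscreteValuationRing localRing

namespace CurvePoint

variable {K F : Type*} [Field K] [Field F] [Algebra K F]

instance (P : CurvePoint K F) : IsDiscreteValuationRing P.localRing := P.isDVR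

instance (P : CurvePoint K F) : Algebra K P.localRing :=
  ((algebraMap K F).codRestrict P.localRing P.algebraMap_mem).toAlgebra

instance (P : CurvePoint K F) : IsScalarTower K P.localRing F :=
  IsScalarTower.of_algebraMap_eq fun _ => rfl

/-- The degree of a closed point: the degree of its residue field over `K`. -/
def degree (P : CurvePoint K F) : ℕ :=
  Module.finrank K (IsLocalRing.ResidueField P.localRing)

/-- The order of vanishing of a rational function at a closed point (with value `0` at the zero
function). -/
def ord (P : CurvePoint K F) (u : F) : ℤ :=
  -WithZero.log ((IsDiscreteValuationRing.maximalIdeal P.localRing).valuation F u)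

theorem ord_one (P : CurvePoint K F) : P.ord 1 = 0 := by
  simp [ord]

theorem ord_mul (P : CurvePoint K F) {u v : F} (hu : u ≠ 0) (hv : v ≠ 0) :
    P.ord (u * v) = P.ord u + P.ord v := by
  simp only [ord, map_mul]
  rw [WithZero.log_mul (by simpa using hu) (by simpa using hv)]
  ring

theorem ord_inv (P : CurvePoint K F) (u : F) : P.ord u⁻¹ = -P.ord u := by
  simp [ord]

end CurvePoint

/-- The group of (`K`-rational) divisors: the free abelian group on the closed points. -/
abbrev CurveDivisor (K F : Type*) [Field K] [Field F] [Algebra K F] : Type _ :=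
  CurvePoint K F →₀ ℤ

namespace CurveDivisor

variable (K F : Type*) [Field K] [Field F] [Algebra K F]

/-- The degree of a divisor, `∑ n_P P ↦ ∑ n_P deg P`. -/
def degree : CurveDivisor K F →+ ℤ :=
  (Finsupp.linearCombination ℤ fun P : CurvePoint K F => (P.degree : ℤ)).toAddMonoidHom

variable {K F} in
/-- `D.IsDivOf u` says that `u` is a nonzero function and `D = div(u)`. -/
def IsDivOf (D : CurveDivisor K F) (u : F) : Prop :=
  u ≠ 0 ∧ ∀ P : CurvePoint K F, D P = P.ord u

/-- The subgroup of principal divisors. -/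
def principal : AddSubgroup (CurveDivisor K F) where
  carrier := {D | ∃ u : F, IsDivOf D u}
  zero_mem' := ⟨1, one_ne_zero, fun P => by simp [CurvePoint.ord_one]⟩
  add_mem' := by
    rintro D E ⟨u, hu, hD⟩ ⟨v, hv, hE⟩
    exact ⟨u * v, mul_ne_zero hu hv, fun P => by
      rw [Finsupp.add_apply, hD, hE, CurvePoint.ord_mul P hu hv]⟩
  neg_mem' := by
    rintro D ⟨u, hu, hD⟩
    exact ⟨u⁻¹, inv_ne_zero hu, fun P => by
      rw [Finsupp.neg_apply, hD, CurvePoint.ord_inv]⟩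

/-- The subgroup of divisors of degree zero. -/
abbrev degreeZero : AddSubgroup (CurveDivisor K F) := (degree K F).ker

/-- `Pic⁰`: degree zero divisors modulo principal divisors. -/
abbrev PicZero : Type _ :=
  degreeZero K F ⧸ (principal K F).addSubgroupOf (degreeZero K F)

end CurveDivisor

/-! ### Hyperelliptic curves with two rational points at infinity -/

/-- The data of a curve `y² = f(x)` over `K`, with `f` monic and separable of degree `2g + 2`. -/
structure HyperellipticCurve (K : Type*) [Field K] (g : ℕ) where
  /-- The polynomial `f` on the right-hand side of the equation. -/
  f : K[X]
  monic : f.Monic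
  separable : f.Separable
  natDegree_eq : f.natDegree = 2 * g + 2

namespace HyperellipticCurve

variable {K : Type*} [Field K] {g : ℕ} (C : HyperellipticCurve K g)

/-- The equation `Y² - f(x)` over `K(x)`. -/
def equation : (RatFunc K)[X] :=
  X ^ 2 - Polynomial.C (algebraMap K[X] (RatFunc K) C.f)

theorem equation_irreducible : Irreducible C.equation := by
  rw [equation]
  refine (X_pow_sub_C_irreducible_iff_of_prime Nat.prime_two).2 fun r hr => ?_
  have hint : IsIntegral K[X] r := by
    refine IsIntegral.of_pow (n := 2) (by norm_num) ?_
    rw [hr]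
    exact isIntegral_algebraMap
  obtain ⟨q, rfl⟩ := IsIntegrallyClosed.isIntegral_iff.1 hint
  rw [← map_pow] at hr
  have hq : q ^ 2 = C.f := IsFractionRing.injective K[X] (RatFunc K) hr
  have hunit : IsUnit q := C.separable.squarefree q (by rw [← sq, hq])
  have h0 := natDegree_eq_zero_of_isUnit (hunit.pow 2)
  rw [hq, C.natDegree_eq] at h0
  omega

instance : Fact (Irreducible C.equation) := ⟨C.equation_irreducible⟩

/-- The function field `K(C) = K(x)[Y] / (Y² - f(x))`. -/
abbrev FunctionField : Type _ := AdjoinRoot C.equation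

/-- The function `y` on the curve. -/
def y : C.FunctionField := AdjoinRoot.root C.equation

/-- A polynomial `p(x)`, as a function on the curve. -/
def polyFun (p : K[X]) : C.FunctionField := algebraMap K[X] C.FunctionField p

/-- The group `J(K)` of rational points of the Jacobian. As the curve has rational points (the two
points at infinity), this is the group of classes of `K`-rational divisors of degree zero. -/
abbrev JacobianPoints : Type _ := CurveDivisor.PicZero K C.FunctionField

end HyperellipticCurve

end

/-! A two-torsion class is the class of some D₀ with 2D₀ = div(u), so u has even order at every
place. Changing u by a constant and by the square of a function w changes D₀ only by div(w). The
theorem therefore reduces to `exists_special`: modulo constants and squares, a function with even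
divisor is one of the listed functions. That div(w) exists and has degree zero is
`hasDegreeZeroDiv`, which rests on the identity ∑ e·f = 2 above each prime of K[x] and above
infinity.

Let σ be the involution y ↦ -y and N(u) = u·σ(u). Comparing orders at ramified and unramified places
forces N(u) = ε s² with ε in K* and s in K(x) (`exists_norm_eq_C_mul_sq`).

If ε is a square, so is N(u), and Hilbert 90 gives u = c·q·z² with q a squarefree polynomial.
Evenness forces q ∣ f and deg q even. Since y² = f, q may be exchanged for f/q, so its degree may be
taken ≤ g + 1. As g is odd, either the degree is ≤ g - 1, which is (i), or f = p p' with both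
degrees g + 1. In the latter case, with h₁ = (p + p')/2, the identity (y - p)² = -2(y - h₁)p
replaces p by y - h₁, which is (ii) with a = 1.

If ε is not a square, the shape of N(u) says that f is a norm from K(√ε)(x). Unique factorisation in
K(√ε)[x] yields f = η η̄ with η = h₁ + √ε h₂ (`exists_norm_form`). Now u(y + h₁) has square norm,
hence equals c·q times a square, with q ∣ f. Write q = δ δ̄ and η = δ e. Exchanging δ for its
conjugate gives δ̄ e = k₁ + √ε k₂, again of norm f, and q(y + h₁)(y + k₁) is a square. So u agrees
with y + k₁, and hence with y - k₁, up to constants and squares: (ii) with a = ε. -/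

noncomputable section

/-! ### Orders of functions at places -/

namespace CurvePoint

open IsDedekindDomain WithZero

section Basic

variable {K F : Type*} [Field K] [Field F] [Algebra K F] (P : CurvePoint K F)

theorem ext_localRing {P Q : CurvePoint K F} (h : P.localRing = Q.localRing) : P = Q := by
  cases P; cases Q; cases h; rfl

theorem ord_nonneg_iff {u : F} (hu : u ≠ 0) : 0 ≤ P.ord u ↔ u ∈ P.localRing := by
  have hv : (IsDiscreteValuationRing.maximalIdeal P.localRing).valuation F u ≠ 0 := by simpa using hu
  have h1 : 0 ≤ P.ord u ↔ (IsDiscreteValuationRing.maximalIdeal P.localRing).valuation F u ≤ 1 := by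
    rw [ord, ← log_le_log hv one_ne_zero, log_one]
    omega
  rw [h1]
  refine ⟨fun h => ?_, fun h => ?_⟩
  · obtain ⟨a, rfl⟩ := IsDiscreteValuationRing.exists_lift_of_le_one h
    exact a.2
  · exact HeightOneSpectrum.valuation_le_one _ (⟨u, h⟩ : P.localRing)

theorem exists_ord_eq_one : ∃ t : F, t ≠ 0 ∧ P.ord t = 1 := by
  obtain ⟨t, ht⟩ := HeightOneSpectrum.valuation_exists_uniformizer F
    (IsDiscreteValuationRing.maximalIdeal P.localRing)
  refine ⟨t, ?_, ?_⟩
  · rintro rfl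
    rw [map_zero] at ht
    exact exp_ne_zero ht.symm
  · rw [ord, ht]
    simp

theorem ord_zero : P.ord 0 = 0 := by
  simp [ord]

theorem ord_neg (u : F) : P.ord (-u) = P.ord u := by
  simp [ord]

theorem ord_zpow (u : F) (n : ℤ) : P.ord (u ^ n) = n * P.ord u := by
  simp [ord]

theorem ord_pow (u : F) (n : ℕ) : P.ord (u ^ n) = n * P.ord u := by
  simp [ord]

theorem ord_div {u v : F} (hu : u ≠ 0) (hv : v ≠ 0) : P.ord (u / v) = P.ord u - P.ord v := by
  rw [div_eq_mul_inv, ord_mul P hu (inv_ne_zero hv), ord_inv, sub_eq_add_neg]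

theorem le_ord_add {u v : F} {n : ℤ} (hu : n ≤ P.ord u) (hv : n ≤ P.ord v) (hu0 : u ≠ 0)
    (hv0 : v ≠ 0) (h : u + v ≠ 0) : n ≤ P.ord (u + v) := by
  have hadd := ((IsDiscreteValuationRing.maximalIdeal P.localRing).valuation F).map_add u v
  rw [le_max_iff] at hadd
  simp only [ord] at *
  rcases hadd with h' | h' <;>
  · have := (log_le_log (by simpa using h) (by simpa)).2 h'
    omega

theorem ord_algebraMap {c : K} (hc : c ≠ 0) : P.ord (algebraMap K F c) = 0 := by
  have h1 := (P.ord_nonneg_iff (u := algebraMap K F c) (by simpa using hc)).2 (P.algebraMap_mem c)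
  have h2 := (P.ord_nonneg_iff (u := algebraMap K F c⁻¹) (by simpa using hc)).2
    (P.algebraMap_mem c⁻¹)
  rw [map_inv₀, ord_inv] at h2
  omega

/-- The order function is characterised by multiplicativity, its sign and normalisation. -/
theorem ord_eq_of {w : F → ℤ} (hmul : ∀ u v, u ≠ 0 → v ≠ 0 → w (u * v) = w u + w v)
    (hw : ∀ u, u ≠ 0 → (0 ≤ w u ↔ u ∈ P.localRing)) {t : F} (ht0 : t ≠ 0) (ht : w t = 1)
    {u : F} (hu : u ≠ 0) : P.ord u = w u := by
  have h1 : w 1 = 0 := by simpa using hmul 1 1 one_ne_zero one_ne_zero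
  have hinv : ∀ x, x ≠ 0 → w x⁻¹ = -w x := fun x hx => by
    have := hmul x x⁻¹ hx (inv_ne_zero hx)
    rw [mul_inv_cancel₀ hx, h1] at this
    omega
  have hnat : ∀ n : ℕ, w (t ^ n) = n := fun n => by
    induction n with
    | zero => simp [h1]
    | succ n ih => rw [pow_succ, hmul _ _ (pow_ne_zero _ ht0) ht0, ih, ht]; simp
  have hz : ∀ n : ℤ, w (t ^ n) = n := fun n => by
    obtain ⟨m, rfl | rfl⟩ := n.eq_nat_or_neg
    · rw [zpow_natCast, hnat]
    · rw [zpow_neg, zpow_natCast, hinv _ (pow_ne_zero _ ht0), hnat]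
  have hunit : ∀ x, x ≠ 0 → w x = 0 → P.ord x = 0 := fun x hx h => by
    have a := (P.ord_nonneg_iff hx).2 ((hw x hx).1 h.ge)
    have b := (P.ord_nonneg_iff (inv_ne_zero hx)).2
      ((hw _ (inv_ne_zero hx)).1 (by rw [hinv x hx]; omega))
    rw [ord_inv] at b
    omega
  have key : ∀ x, x ≠ 0 → P.ord x = w x * P.ord t := fun x hx => by
    have hne : t ^ (-(w x)) ≠ 0 := zpow_ne_zero _ ht0
    have := hunit (x * t ^ (-(w x))) (mul_ne_zero hx hne) (by rw [hmul _ _ hx hne, hz]; omega)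
    rw [ord_mul P hx hne, ord_zpow] at this
    linarith
  have hpos : 0 ≤ P.ord t := (P.ord_nonneg_iff ht0).2 ((hw t ht0).1 (by omega))
  obtain ⟨s, hs0, hs⟩ := P.exists_ord_eq_one
  have hs' := key s hs0
  rw [hs] at hs'
  -- At a uniformizer s, `key` reads 1 = w(s)·ord(t), so ord(t) is a nonnegative divisor of 1.
  have ht1 : P.ord t = 1 := Int.eq_one_of_dvd_one hpos ⟨w s, by rw [mul_comm]; exact hs'⟩
  rw [key u hu, ht1, mul_one]

end Basic

/-! ### Action of automorphisms of the function field on places -/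

section Comap

variable {K F : Type*} [Field K] [Field F] [Algebra K F]

theorem ord_add_of_lt (P : CurvePoint K F) {u v : F} (hu : u ≠ 0) (hv : v ≠ 0)
    (h : P.ord u < P.ord v) : P.ord (u + v) = P.ord u := by
  have h0 : u + v ≠ 0 := by
    intro h0
    rw [eq_neg_of_add_eq_zero_left h0, ord_neg] at h
    exact h.false
  refine le_antisymm ?_ (le_ord_add P le_rfl h.le hu hv h0)
  by_contra hlt
  rw [not_le] at hlt
  have h1 : u + v + -v ≠ 0 := by simpa using hu
  have := le_ord_add P (n := P.ord u + 1) (u := u + v) (v := -v) (by omega)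
    (by rw [ord_neg]; omega) h0 (neg_ne_zero.2 hv) h1
  rw [add_neg_cancel_right] at this
  omega

/-- The preimage of a place under an automorphism of the function field. -/
def comap (σ : F ≃ₐ[K] F) (P : CurvePoint K F) : CurvePoint K F where
  localRing := P.localRing.comap (σ : F →+* F)
  algebraMap_mem c := by
    rw [ValuationSubring.mem_comap]
    simpa using P.algebraMap_mem c
  isDVR := by
    let e : P.localRing.comap (σ : F →+* F) ≃+* P.localRing :=
      { toFun := fun z => ⟨σ z, z.2⟩
        invFun := fun z => ⟨σ.symm z, by
          rw [ValuationSubring.mem_comap]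
          simp⟩
        left_inv := fun z => Subtype.ext (by simp)
        right_inv := fun z => Subtype.ext (by simp)
        map_mul' := fun a b => Subtype.ext (by simp)
        map_add' := fun a b => Subtype.ext (by simp) }
    exact IsDiscreteValuationRing.RingEquivClass.isDiscreteValuationRing e.symm

theorem mem_comap_localRing {σ : F ≃ₐ[K] F} {P : CurvePoint K F} {u : F} :
    u ∈ (P.comap σ).localRing ↔ σ u ∈ P.localRing := Iff.rfl

theorem ord_comap (σ : F ≃ₐ[K] F) (P : CurvePoint K F) (u : F) :
    (P.comap σ).ord u = P.ord (σ u) := by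
  by_cases hu : u = 0
  · simp [hu, ord]
  obtain ⟨t, ht0, ht⟩ := P.exists_ord_eq_one
  refine ord_eq_of _ (w := fun u => P.ord (σ u)) (t := σ.symm t) ?_ ?_ ?_ ?_ hu
  · intro a b ha hb
    rw [map_mul, ord_mul P (by simpa using ha) (by simpa using hb)]
  · intro a ha
    rw [mem_comap_localRing]
    exact P.ord_nonneg_iff (by simpa using ha)
  · simpa using ht0
  · simpa using ht

theorem degree_comap (σ : F ≃ₐ[K] F) (P : CurvePoint K F) : (P.comap σ).degree = P.degree := by
  let e : (P.comap σ).localRing ≃ₐ[K] P.localRing :=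
    { toFun := fun z => ⟨σ z, z.2⟩
      invFun := fun z => ⟨σ.symm z, by
        rw [mem_comap_localRing]
        simp⟩
      left_inv := fun z => Subtype.ext (by simp)
      right_inv := fun z => Subtype.ext (by simp)
      map_mul' := fun a b => Subtype.ext (by simp)
      map_add' := fun a b => Subtype.ext (by simp)
      commutes' := fun c => Subtype.ext (σ.commutes c) }
  refine Algebra.finrank_eq_of_equiv_equiv (RingEquiv.refl K)
    (IsLocalRing.ResidueField.mapEquiv e.toRingEquiv) ?_
  ext c
  change algebraMap K (IsLocalRing.ResidueField P.localRing) c =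
    IsLocalRing.ResidueField.map (e.toRingEquiv : _ →+* _)
      (IsLocalRing.residue _ (algebraMap K (P.comap σ).localRing c))
  rw [IsLocalRing.ResidueField.map_residue]
  exact congrArg (IsLocalRing.residue P.localRing) (e.commutes c).symm

end Comap

/-! ### Places attached to primes of a Dedekind domain -/

section OfHeightOne

variable {K F S : Type*} [Field K] [Field F] [Algebra K F] [CommRing S] [IsDedekindDomain S]
  [Algebra S F] [IsFractionRing S F] [Algebra K S] [IsScalarTower K S F]

variable (K F) in
/-- The place attached to a nonzero prime ideal of a Dedekind domain with fraction field `F`. -/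
def ofHeightOne (v : HeightOneSpectrum S) : CurvePoint K F where
  localRing := (v.valuation F).valuationSubring
  algebraMap_mem c := by
    rw [IsScalarTower.algebraMap_apply K S F]
    exact v.valuation_le_one _
  isDVR := by
    have : (v.valuation F).IsRankOneDiscrete :=
      Valuation.IsRankOneDiscrete.mk' (v.valuation F)
    infer_instance

theorem mem_ofHeightOne {v : HeightOneSpectrum S} {u : F} :
    u ∈ (ofHeightOne K F v).localRing ↔ v.valuation F u ≤ 1 := Iff.rfl

theorem ord_ofHeightOne (v : HeightOneSpectrum S) (u : F) :
    (ofHeightOne K F v).ord u = -log (v.valuation F u) := by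
  by_cases hu : u = 0
  · simp [hu, ord]
  obtain ⟨t, ht⟩ := v.valuation_exists_uniformizer F
  refine ord_eq_of _ (w := fun u => -log (v.valuation F u)) ?_ ?_ (t := t) ?_ ?_ hu
  · intro a b ha hb
    rw [map_mul, log_mul (by simpa using ha) (by simpa using hb)]
    ring
  · intro a ha
    have hv : v.valuation F a ≠ 0 := by simpa using ha
    rw [mem_ofHeightOne, ← log_le_log hv one_ne_zero, log_one]
    omega
  · rintro rfl
    rw [map_zero] at ht
    exact exp_ne_zero ht.symm
  · rw [ht]
    simp

theorem ord_ofHeightOne_pos_iff (v : HeightOneSpectrum S) {s : S} (hs : s ≠ 0) :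
    0 < (ofHeightOne K F v).ord (algebraMap S F s) ↔ s ∈ v.asIdeal := by
  have h0 : v.valuation F (algebraMap S F s) ≠ 0 := by simpa using hs
  rw [ord_ofHeightOne, ← v.valuation_lt_one_iff_mem (K := F), ← log_lt_log h0 one_ne_zero, log_one]
  omega

theorem ofHeightOne_injective :
    Function.Injective (ofHeightOne K F : HeightOneSpectrum S → CurvePoint K F) := by
  intro v w h
  ext s
  by_cases hs : s = 0
  · simp [hs]
  rw [← ord_ofHeightOne_pos_iff (K := K) (F := F) v hs, h, ord_ofHeightOne_pos_iff w hs]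

/-- The prime is the centre of P on S, the set of elements of positive order. It is nonzero, since
otherwise every nonzero element of S, hence every fraction, would have order 0. The local ring at
the centre and that of P then agree. -/
theorem eq_ofHeightOne (P : CurvePoint K F) (hP : ∀ s : S, algebraMap S F s ∈ P.localRing) :
    ∃ v : HeightOneSpectrum S, P = ofHeightOne K F v := by
  let φ : S →+* P.localRing := (algebraMap S F).codRestrict P.localRing hP
  have hord : ∀ s : S, s ≠ 0 → (s ∈ (IsLocalRing.maximalIdeal P.localRing).comap φ ↔
      0 < P.ord (algebraMap S F s)) := by
    intro s hs
    have hs' : algebraMap S F s ≠ 0 := by simpa using hs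
    have hn := (P.ord_nonneg_iff hs').2 (hP s)
    have hi := P.ord_nonneg_iff (inv_ne_zero hs')
    rw [ord_inv] at hi
    rw [Ideal.mem_comap, IsLocalRing.mem_maximalIdeal, mem_nonunits_iff]
    have hu : IsUnit (φ s) ↔ (algebraMap S F s)⁻¹ ∈ P.localRing := by
      constructor
      · rintro ⟨w, hw⟩
        have : (algebraMap S F s)⁻¹ = ((w⁻¹ : P.localRingˣ) : P.localRing) := by
          refine inv_eq_of_mul_eq_one_right ?_
          have := congrArg (Subtype.val) w.mul_inv
          rw [hw] at this
          exact this
        rw [this]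
        exact Subtype.property _
      · intro h
        exact IsUnit.of_mul_eq_one (⟨_, h⟩ : P.localRing) (Subtype.ext (mul_inv_cancel₀ hs'))
    rw [hu, ← hi]
    omega
  let v : HeightOneSpectrum S :=
    { asIdeal := (IsLocalRing.maximalIdeal P.localRing).comap φ
      isPrime := inferInstance
      ne_bot := by
        intro hbot
        obtain ⟨t, ht0, ht⟩ := P.exists_ord_eq_one
        obtain ⟨a, b, hb, rfl⟩ := IsFractionRing.div_surjective S t
        have hb0 : b ≠ 0 := nonZeroDivisors.ne_zero hb
        have ha0 : a ≠ 0 := by rintro rfl; simp at ht0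
        have hzero : ∀ s : S, s ≠ 0 → P.ord (algebraMap S F s) = 0 := fun s hs => by
          have h1 := (hord s hs).not
          rw [hbot, Ideal.mem_bot] at h1
          have h2 := (P.ord_nonneg_iff (u := algebraMap S F s) (by simpa using hs)).2 (hP s)
          have := h1.1 hs
          omega
        rw [ord_div P (by simpa using ha0) (by simpa using hb0), hzero a ha0, hzero b hb0] at ht
        omega }
  refine ⟨v, ext_localRing ?_⟩
  ext z
  rw [mem_ofHeightOne]
  by_cases hz : z = 0
  · simp [hz]
  -- Write z = n/d with d outside the centre: d is a unit for both valuations, so z may be replaced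
  -- by n in S.
  have aux : ∀ z : F, z ≠ 0 → v.valuation F z ≤ 1 → ∃ (n : S) (d : S), d ∉ v.asIdeal ∧ n ≠ 0 ∧
      P.ord z = P.ord (algebraMap S F n) ∧ v.valuation F z = v.valuation F (algebraMap S F n) := by
    intro z hz hz1
    obtain ⟨n, ⟨d, hd⟩, hnd⟩ := v.exists_primeCompl_mul_eq_of_integer z hz1
    have hdv : d ∉ v.asIdeal := hd
    have hd0 : d ≠ 0 := by rintro rfl; exact hdv (Ideal.zero_mem _)
    have hd0' : algebraMap S F d ≠ 0 := by simpa using hd0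
    have hn0 : n ≠ 0 := by
      rintro rfl
      simp [hz, hd0] at hnd
    refine ⟨n, d, hdv, hn0, ?_, ?_⟩
    · rw [← hnd, ord_mul P hz hd0']
      have h1 := (hord d hd0).not.1 hdv
      have h2 := (P.ord_nonneg_iff hd0').2 (hP d)
      omega
    · rw [← hnd, map_mul, (v.valuation_eq_one_iff_notMem (K := F)).2 hdv, mul_one]
  constructor
  · intro hzP
    by_contra hlt
    rw [not_le] at hlt
    have hlt' : v.valuation F z⁻¹ < 1 := by
      rw [map_inv₀]
      exact inv_lt_one_of_one_lt₀ hlt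
    obtain ⟨n, d, -, hn0, h1, h2⟩ := aux z⁻¹ (inv_ne_zero hz) hlt'.le
    rw [h2, v.valuation_lt_one_iff_mem] at hlt'
    have h3 := (hord n hn0).1 hlt'
    rw [← h1, ord_inv] at h3
    have h4 := (P.ord_nonneg_iff hz).2 hzP
    omega
  · intro hz1
    obtain ⟨n, d, -, hn0, h1, -⟩ := aux z hz hz1
    rw [← P.ord_nonneg_iff hz, h1]
    exact (P.ord_nonneg_iff (by simpa using hn0)).2 (hP n)

/-- The residue field of the local ring is already S modulo the prime: if z = n/d and d' inverts d
modulo the prime, then n d' has the same residue as z. -/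
theorem degree_ofHeightOne (v : HeightOneSpectrum S) :
    (ofHeightOne K F v).degree = Module.finrank K (S ⧸ v.asIdeal) := by
  let P := ofHeightOne K F v
  let φ : S →ₐ[K] P.localRing :=
    { (algebraMap S F).codRestrict P.localRing (fun s => v.valuation_le_one s) with
      commutes' := fun c => Subtype.ext (IsScalarTower.algebraMap_apply K S F c).symm }
  have hφ : ∀ s, ((φ s : P.localRing) : F) = algebraMap S F s := fun _ => rfl
  let ψ : S →ₐ[K] IsLocalRing.ResidueField P.localRing :=
    (IsScalarTower.toAlgHom K P.localRing (IsLocalRing.ResidueField P.localRing)).comp φ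
  have hmem : ∀ z : P.localRing, IsLocalRing.residue P.localRing z = 0 ↔
      v.valuation F (z : F) < 1 := by
    intro z
    rw [IsLocalRing.residue_eq_zero_iff]
    exact (v.valuation F).mem_maximalIdeal_iff
  have hψ : ∀ s, ψ s = IsLocalRing.residue P.localRing (φ s) := fun _ => rfl
  have hker : RingHom.ker ψ = v.asIdeal := by
    ext s
    rw [RingHom.mem_ker, hψ, hmem, hφ, v.valuation_lt_one_iff_mem]
  have hsurj : Function.Surjective ψ := by
    intro y
    obtain ⟨⟨z, hz⟩, rfl⟩ := IsLocalRing.residue_surjective y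
    obtain ⟨n, ⟨d, hd⟩, hnd⟩ := v.exists_primeCompl_mul_eq_of_integer z hz
    have hdv : d ∉ v.asIdeal := hd
    obtain ⟨d', i, hi, hd'⟩ := v.isMaximal.exists_inv hdv
    refine ⟨n * d', ?_⟩
    rw [hψ, ← sub_eq_zero, ← map_sub, hmem]
    have h1 : v.valuation F (algebraMap S F d) = 1 := (v.valuation_eq_one_iff_notMem).2 hdv
    have h2 : ((φ (n * d') - ⟨z, hz⟩ : P.localRing) : F) * algebraMap S F d =
        algebraMap S F (-(n * i)) := by
      have h3 : ((φ (n * d') - ⟨z, hz⟩ : P.localRing) : F) = algebraMap S F (n * d') - z := rfl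
      have h4 : -(n * i) = n * (d' * d) - n := by
        linear_combination -n * hd'
      rw [h3, sub_mul, h4, map_sub, ← hnd]
      simp only [map_mul]
      ring
    have h5 := congrArg (v.valuation F) h2
    rw [map_mul, h1, mul_one] at h5
    rw [h5, v.valuation_lt_one_iff_mem]
    exact neg_mem (Ideal.mul_mem_left _ _ hi)
  have e := Ideal.quotientKerAlgEquivOfSurjective hsurj
  rw [degree, ← e.toLinearEquiv.finrank_eq]
  exact (Ideal.quotientEquivAlgOfEq K hker).toLinearEquiv.finrank_eq

end OfHeightOne

/-! ### The fundamental identity ∑ e·f = n -/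

section Sum

variable (K : Type*) {A E : Type*} (F : Type*) [Field K] [CommRing A] [IsDedekindDomain A] [Field E]
  [Field F] [Algebra K A] [Algebra K F] [Algebra A E] [IsFractionRing A E] [Algebra E F]
  [Algebra A F] [IsScalarTower A E F] [IsScalarTower K A F] [FiniteDimensional E F]
  [Algebra.IsSeparable E F]

variable (E) in
/-- The fundamental identity for the places above a principal prime of a Dedekind domain. -/
theorem exists_finset_sum_ord_mul_degree {π : A} (hπ : Prime π) :
    ∃ T : Finset (CurvePoint K F),
      (∀ P : CurvePoint K F, P ∈ T ↔
        (∀ a : A, algebraMap A F a ∈ P.localRing) ∧ 0 < P.ord (algebraMap A F π)) ∧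
      ∑ P ∈ T, P.ord (algebraMap A F π) * P.degree =
        Module.finrank E F * Module.finrank K (A ⧸ Ideal.span {π}) ∧
      ∀ P ∈ T, (∀ r : E, P.ord (algebraMap A F π) ∣ P.ord (algebraMap E F r)) ∧
        ∃ k : ℕ, 0 < k ∧ P.degree = k * Module.finrank K (A ⧸ Ideal.span {π}) := by
  classical
  -- A place whose ring contains A contains S, because valuation rings are integrally closed. So the
  -- places wanted come from the primes of S over (π); there the order of π is the ramification
  -- index and the degree is the inertia degree times the residue degree of (π).
  let S := integralClosure A F
  have : IsDedekindDomain S := IsIntegralClosure.isDedekindDomain A E F S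
  have : IsFractionRing S F := IsIntegralClosure.isFractionRing_of_finite_extension A E F S
  have : Module.Finite A S := IsIntegralClosure.finite A E F S
  have hAF : Function.Injective (algebraMap A F) := by
    rw [IsScalarTower.algebraMap_eq A E F]
    exact (algebraMap E F).injective.comp (IsFractionRing.injective A E)
  have hASF : ∀ a, algebraMap S F (algebraMap A S a) = algebraMap A F a := fun _ => rfl
  have hAS : Function.Injective (algebraMap A S) := fun a b h => hAF (by
    rw [← hASF, h, hASF])
  have : Module.IsTorsionFree A S := by
    rw [Module.isTorsionFree_iff_algebraMap_injective]
    exact hAS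
  let p : HeightOneSpectrum A :=
    { asIdeal := Ideal.span {π}
      isPrime := (Ideal.span_singleton_prime hπ.ne_zero).2 hπ
      ne_bot := by simpa using hπ.ne_zero }
  have hpm : p.asIdeal.IsMaximal := p.isMaximal
  have hprimes : ∀ Q ∈ IsDedekindDomain.primesOverFinset p.asIdeal S,
      Q.IsPrime ∧ Q.LiesOver p.asIdeal := fun Q hQ =>
    (IsDedekindDomain.mem_primesOverFinset_iff p.ne_bot S).1 hQ
  let w : {Q // Q ∈ IsDedekindDomain.primesOverFinset p.asIdeal S} → HeightOneSpectrum S := fun Q =>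
    { asIdeal := Q.1
      isPrime := (hprimes Q.1 Q.2).1
      ne_bot := by
        have := (hprimes Q.1 Q.2).2
        exact Ideal.ne_bot_of_liesOver_of_ne_bot p.ne_bot Q.1 }
  have hmemT : ∀ P : CurvePoint K F,
      P ∈ (IsDedekindDomain.primesOverFinset p.asIdeal S).attach.image
        (fun Q => ofHeightOne K F (w Q)) ↔
      (∀ a : A, algebraMap A F a ∈ P.localRing) ∧ 0 < P.ord (algebraMap A F π) := by
    intro P
    rw [Finset.mem_image]
    constructor
    · rintro ⟨Q, -, rfl⟩
      have := (hprimes Q.1 Q.2).2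
      refine ⟨fun a => ?_, ?_⟩
      · rw [← hASF]
        exact (w Q).valuation_le_one _
      · rw [← hASF, ord_ofHeightOne_pos_iff _
          (fun h => hπ.ne_zero (hAS (by rw [h, map_zero])))]
        have h1 : π ∈ p.asIdeal := Ideal.mem_span_singleton_self π
        rw [this.over] at h1
        exact h1
    · rintro ⟨h1, h2⟩
      have hS : ∀ s : S, algebraMap S F s ∈ P.localRing := by
        intro s
        have hs : IsIntegral A (algebraMap S F s) := s.2
        let φ : A →+* P.localRing := (algebraMap A F).codRestrict P.localRing h1
        obtain ⟨q, hq, hq0⟩ := hs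
        have : IsIntegral P.localRing (algebraMap S F s) := by
          refine ⟨q.map φ, hq.map φ, ?_⟩
          rw [eval₂_map]
          exact hq0
        obtain ⟨y, hy⟩ := IsIntegrallyClosed.isIntegral_iff.1 this
        rw [← hy]
        exact y.2
      obtain ⟨v, rfl⟩ := eq_ofHeightOne P hS
      rw [← hASF, ord_ofHeightOne_pos_iff _
          (fun h => hπ.ne_zero (hAS (by rw [h, map_zero])))] at h2
      have hover : v.asIdeal.LiesOver p.asIdeal := by
        constructor
        refine hpm.eq_of_le (Ideal.IsPrime.under A v.asIdeal).ne_top ?_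
        rw [Ideal.span_le, Set.singleton_subset_iff]
        exact h2
      exact ⟨⟨v.asIdeal, (IsDedekindDomain.mem_primesOverFinset_iff p.ne_bot S).2
        ⟨v.isPrime, hover⟩⟩, Finset.mem_attach _ _, rfl⟩
  have hord : ∀ Q, (ofHeightOne K F (w Q)).ord (algebraMap A F π) =
      p.asIdeal.ramificationIdx' Q.1 := by
    intro Q
    have : ((w Q).asIdeal).LiesOver p.asIdeal := (hprimes Q.1 Q.2).2
    rw [ord_ofHeightOne, ← hASF, HeightOneSpectrum.valuation_of_algebraMap,
      ← HeightOneSpectrum.intValuation_liesOver p (w Q),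
      p.intValuation_singleton hπ.ne_zero rfl]
    simp [w]
  have hdeg : ∀ Q, (ofHeightOne K F (w Q)).degree =
      p.asIdeal.inertiaDeg' Q.1 * Module.finrank K (A ⧸ p.asIdeal) := by
    intro Q
    have := (hprimes Q.1 Q.2).2
    have hKAS : IsScalarTower K A S := inferInstance
    let _ : Field (A ⧸ p.asIdeal) := Ideal.Quotient.field _
    have : IsScalarTower K (A ⧸ p.asIdeal) (S ⧸ Q.1) := inferInstance
    rw [degree_ofHeightOne, Ideal.inertiaDeg'_algebraMap, mul_comm,
      Module.finrank_mul_finrank]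
  refine ⟨_, hmemT, ?_, ?_⟩
  · rw [Finset.sum_image, ← Ideal.sum_ramification_inertia S E F p.ne_bot,
      ← Finset.sum_attach (IsDedekindDomain.primesOverFinset p.asIdeal S)]
    · push_cast
      rw [Finset.sum_mul]
      refine Finset.sum_congr rfl fun Q _ => ?_
      rw [hord, hdeg]
      push_cast
      ring
    · intro Q _ Q' _ h
      have := ofHeightOne_injective h
      exact Subtype.ext (congrArg HeightOneSpectrum.asIdeal this)
  · intro P hP
    obtain ⟨Q, -, rfl⟩ := Finset.mem_image.1 hP
    have hQ := (hprimes Q.1 Q.2).1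
    have hQ2 : ((w Q).asIdeal).LiesOver p.asIdeal := (hprimes Q.1 Q.2).2
    refine ⟨fun r => ?_, _, ?_, hdeg Q⟩
    · rw [hord, ord_ofHeightOne, ← HeightOneSpectrum.valuation_liesOver F p (w Q) r, log_pow,
        dvd_neg, nsmul_eq_mul]
      exact dvd_mul_right _ _
    · have : Q.1.LiesOver p.asIdeal := hQ2
      exact Ideal.inertiaDeg'_pos p.asIdeal Q.1

end Sum

end CurvePoint

/-! ### The place at infinity of K(x) -/

namespace RatFunc

open scoped Classical

variable (K : Type*) [Field K]

/-- The place at infinity of the rational function field. -/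
def inftyPoint : CurvePoint K (RatFunc K) where
  localRing := (inftyValuation K).valuationSubring
  algebraMap_mem c := by
    rw [Valuation.mem_valuationSubring_iff, algebraMap_eq_C]
    by_cases hc : c = 0
    · simp [hc]
    · rw [inftyValuation.C _ hc]
  isDVR := by
    have : (inftyValuation K).IsRankOneDiscrete := Valuation.IsRankOneDiscrete.mk' (inftyValuation K)
    infer_instance

variable {K}

theorem mem_inftyPoint {r : RatFunc K} :
    r ∈ (inftyPoint K).localRing ↔ inftyValuation K r ≤ 1 := Iff.rfl

theorem inftyValuation_lt_one_iff {r : RatFunc K} :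
    inftyValuation K r < 1 ↔ inftyValuation K (r * X) ≤ 1 := by
  by_cases hr : r = 0
  · simp [hr]
  have h1 : inftyValuation K r ≠ 0 := by simpa using hr
  have h2 : inftyValuation K (r * X) ≠ 0 := by simp [hr]
  rw [← WithZero.log_lt_log h1 one_ne_zero, ← WithZero.log_le_log h2 one_ne_zero, map_mul,
    inftyValuation.X, WithZero.log_mul h1 WithZero.exp_ne_zero,
    WithZero.log_exp, WithZero.log_one]
  omega

/-- The uniformizer `1 / X` at infinity. -/
def inftyUniformizer (K : Type*) [Field K] : (inftyPoint K).localRing :=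
  ⟨(X : RatFunc K)⁻¹, by
    rw [mem_inftyPoint]
    refine (inftyValuation_lt_one_iff.2 ?_).le
    rw [inv_mul_cancel₀ X_ne_zero, map_one]⟩

theorem span_inftyUniformizer :
    Ideal.span {inftyUniformizer K} = IsLocalRing.maximalIdeal (inftyPoint K).localRing := by
  ext ⟨r, hr⟩
  rw [Ideal.mem_span_singleton]
  refine Iff.trans ?_ (inftyValuation K).mem_maximalIdeal_iff.symm
  rw [inftyValuation_lt_one_iff]
  constructor
  · rintro ⟨⟨s, hs⟩, h⟩
    have h' : r = X⁻¹ * s := congrArg Subtype.val h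
    have h1 : r * X = s := by
      rw [h', mul_comm, ← mul_assoc, mul_inv_cancel₀ X_ne_zero, one_mul]
    exact (congrArg (inftyValuation K) h1).le.trans hs
  · intro h
    refine ⟨⟨r * X, h⟩, Subtype.ext ?_⟩
    change r = X⁻¹ * (r * X)
    rw [mul_comm, mul_assoc, mul_inv_cancel₀ X_ne_zero, mul_one]

theorem inftyUniformizer_prime : Prime (inftyUniformizer K) := by
  have h0 : inftyUniformizer K ≠ 0 := fun h =>
    inv_ne_zero (X_ne_zero (K := K)) (congrArg Subtype.val h)
  rw [← Ideal.span_singleton_prime h0, span_inftyUniformizer]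
  infer_instance

/-- The value at infinity is a ratio of coefficients in the degree of the denominator. The
denominator is monic, so c is the coefficient of the numerator there, and subtracting c times the
denominator lowers the degree. -/
theorem exists_inftyValuation_sub_C_lt_one {r : RatFunc K} (hr : inftyValuation K r ≤ 1) :
    ∃ c : K, inftyValuation K (r - C c) < 1 := by
  by_cases hr0 : r = 0
  · exact ⟨0, by simp [hr0]⟩
  have hd := r.denom_ne_zero
  have hmon := r.monic_denom
  have hdeg : r.num.natDegree ≤ r.denom.natDegree := by
    rw [inftyValuation_apply, inftyValuation_of_nonzero K hr0, ← WithZero.log_le_log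
      WithZero.exp_ne_zero one_ne_zero, WithZero.log_exp, WithZero.log_one, intDegree] at hr
    omega
  refine ⟨r.num.coeff r.denom.natDegree, ?_⟩
  set c := r.num.coeff r.denom.natDegree with hc
  set q := r.num - Polynomial.C c * r.denom with hq
  have hrq : r - C c = algebraMap K[X] (RatFunc K) q / algebraMap K[X] (RatFunc K) r.denom := by
    have hd' : algebraMap K[X] (RatFunc K) r.denom ≠ 0 := by simpa using hd
    rw [eq_div_iff hd', sub_mul, hq, map_sub, map_mul, algebraMap_C]
    congr 1
    rw [← eq_div_iff hd', num_div_denom]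
  by_cases hq0 : q = 0
  · rw [hrq, hq0]
    simp
  have hlt : q.natDegree < r.denom.natDegree := by
    have h1 : q.natDegree ≤ r.denom.natDegree :=
      (natDegree_sub_le _ _).trans (max_le hdeg (natDegree_C_mul_le _ _))
    refine lt_of_le_of_ne h1 fun h => hq0 ?_
    rw [← leadingCoeff_eq_zero, leadingCoeff, h, hq, coeff_sub, coeff_C_mul, ← hc,
      hmon.coeff_natDegree]
    ring
  rw [hrq, map_div₀, inftyValuation_apply, inftyValuation_apply, inftyValuation.polynomial K hq0,
    inftyValuation.polynomial K hd, div_lt_one₀ (by simp), WithZero.exp_lt_exp]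
  exact_mod_cast hlt

theorem finrank_quotient_inftyUniformizer :
    Module.finrank K ((inftyPoint K).localRing ⧸ Ideal.span {inftyUniformizer K}) = 1 := by
  have hne : Ideal.span {inftyUniformizer K} ≠ ⊤ := by
    rw [span_inftyUniformizer]
    exact (IsLocalRing.maximalIdeal.isMaximal _).ne_top
  have : Nontrivial ((inftyPoint K).localRing ⧸ Ideal.span {inftyUniformizer K}) :=
    Ideal.Quotient.nontrivial_iff.2 hne
  rw [finrank_eq_one_iff_of_nonzero' _ (one_ne_zero)]
  intro w
  obtain ⟨⟨r, hr⟩, rfl⟩ := Ideal.Quotient.mk_surjective w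
  obtain ⟨c, hc⟩ := exists_inftyValuation_sub_C_lt_one hr
  refine ⟨c, ?_⟩
  rw [← Algebra.algebraMap_eq_smul_one]
  refine Eq.symm (Ideal.Quotient.eq.2 ?_)
  rw [span_inftyUniformizer]
  exact (inftyValuation K).mem_maximalIdeal_iff.2 hc

end RatFunc

/-! ### The function field as a quadratic extension of K(x) -/

namespace HyperellipticCurve

variable {K : Type*} [Field K] {g : ℕ} (C : HyperellipticCurve K g)

section Field

theorem equation_monic : C.equation.Monic := monic_X_pow_sub_C _ two_ne_zero

theorem equation_natDegree : C.equation.natDegree = 2 := natDegree_X_pow_sub_C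

instance : FiniteDimensional (RatFunc K) C.FunctionField := C.equation_monic.finite_adjoinRoot

theorem finrank_functionField : Module.finrank (RatFunc K) C.FunctionField = 2 := by
  rw [(AdjoinRoot.powerBasis C.equation_monic.ne_zero).finrank,
    AdjoinRoot.powerBasis_dim, equation_natDegree]

theorem y_sq : C.y ^ 2 = algebraMap K[X] C.FunctionField C.f := by
  have h : C.y ^ 2 -
      algebraMap (RatFunc K) C.FunctionField (algebraMap K[X] (RatFunc K) C.f) = 0 := by
    have h1 : eval₂ (AdjoinRoot.of C.equation) C.y
        (X ^ 2 - Polynomial.C (algebraMap K[X] (RatFunc K) C.f)) = 0 :=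
      AdjoinRoot.eval₂_root C.equation
    rwa [eval₂_sub, eval₂_pow, eval₂_X, eval₂_C] at h1
  rw [sub_eq_zero] at h
  rw [h, ← IsScalarTower.algebraMap_apply]

theorem exists_eq_add_mul_y (u : C.FunctionField) :
    ∃ a b : RatFunc K, u = algebraMap _ _ a + algebraMap _ _ b * C.y := by
  obtain ⟨p, rfl⟩ := AdjoinRoot.mk_surjective u
  have h1 : AdjoinRoot.mk C.equation p = AdjoinRoot.mk C.equation (p %ₘ C.equation) := by
    rw [← sub_eq_zero, ← map_sub, AdjoinRoot.mk_eq_zero]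
    exact dvd_sub_comm.1 (by
      rw [modByMonic_eq_sub_mul_div p C.equation]
      simp)
  have h2 : (p %ₘ C.equation).natDegree ≤ 1 := by
    have := natDegree_modByMonic_lt p C.equation_monic (by
      intro h
      have := C.equation_natDegree
      rw [h] at this
      simp at this)
    rw [equation_natDegree] at this
    omega
  obtain ⟨b, a, h⟩ := exists_eq_X_add_C_of_natDegree_le_one h2
  refine ⟨a, b, ?_⟩
  rw [h1, h, map_add, map_mul, AdjoinRoot.mk_X, AdjoinRoot.mk_C, AdjoinRoot.mk_C, add_comm]
  rfl

theorem add_mul_y_eq_zero_iff {a b : RatFunc K} :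
    algebraMap _ C.FunctionField a + algebraMap _ _ b * C.y = 0 ↔ a = 0 ∧ b = 0 := by
  refine ⟨fun h => ?_, fun ⟨ha, hb⟩ => by simp [ha, hb]⟩
  have h1 : AdjoinRoot.mk C.equation (Polynomial.C b * X + Polynomial.C a) = 0 := by
    rw [map_add, map_mul, AdjoinRoot.mk_X, AdjoinRoot.mk_C, AdjoinRoot.mk_C, add_comm]
    exact h
  rw [AdjoinRoot.mk_eq_zero] at h1
  have h2 : Polynomial.C b * X + Polynomial.C a = 0 := by
    by_contra h0
    have h3 := natDegree_le_of_dvd h1 h0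
    have h4 := natDegree_linear_le (a := b) (b := a)
    rw [equation_natDegree] at h3
    omega
  have h5 := congrArg (coeff · 0) h2
  have h6 := congrArg (coeff · 1) h2
  simp [coeff_C] at h5 h6
  exact ⟨h5, h6⟩

theorem algebraMap_polynomial_injective :
    Function.Injective (algebraMap K[X] C.FunctionField) := by
  rw [IsScalarTower.algebraMap_eq K[X] (RatFunc K) C.FunctionField]
  exact (algebraMap (RatFunc K) C.FunctionField).injective.comp (RatFunc.algebraMap_injective K)

theorem y_ne_zero : C.y ≠ 0 := by
  intro h
  have := C.y_sq
  rw [h, zero_pow two_ne_zero, eq_comm, map_eq_zero_iff _ C.algebraMap_polynomial_injective] at this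
  exact C.monic.ne_zero this

/-- The hyperelliptic involution on the function field, over `K(x)`. -/
def involutionHom : C.FunctionField →ₐ[RatFunc K] C.FunctionField :=
  AdjoinRoot.liftAlgHom C.equation (Algebra.ofId _ _) (-C.y) (by
    have h := C.y_sq
    rw [IsScalarTower.algebraMap_apply K[X] (RatFunc K)] at h
    simp only [equation, eval₂_sub, eval₂_pow, eval₂_X, eval₂_C, neg_sq, h]
    exact sub_self _)

theorem involutionHom_y : C.involutionHom C.y = -C.y :=
  AdjoinRoot.liftAlgHom_root _ _ _ _

theorem involutionHom_involutionHom (u : C.FunctionField) :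
    C.involutionHom (C.involutionHom u) = u := by
  obtain ⟨a, b, rfl⟩ := C.exists_eq_add_mul_y u
  simp only [map_add, map_mul, AlgHom.commutes, involutionHom_y, map_neg, neg_neg]

/-- The hyperelliptic involution on the function field. -/
def involution : C.FunctionField ≃ₐ[K] C.FunctionField :=
  AlgEquiv.restrictScalars K
    (AlgEquiv.ofAlgHom C.involutionHom C.involutionHom
      (AlgHom.ext C.involutionHom_involutionHom) (AlgHom.ext C.involutionHom_involutionHom))

theorem involution_involution (u : C.FunctionField) : C.involution (C.involution u) = u :=
  C.involutionHom_involutionHom u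

theorem involution_y : C.involution C.y = -C.y := C.involutionHom_y

theorem involution_algebraMap (r : RatFunc K) :
    C.involution (algebraMap _ _ r) = algebraMap _ _ r := C.involutionHom.commutes r

theorem involution_polynomial (p : K[X]) :
    C.involution (algebraMap _ _ p) = algebraMap _ _ p := by
  rw [IsScalarTower.algebraMap_apply K[X] (RatFunc K), involution_algebraMap]

theorem mul_involution (a b : RatFunc K) :
    (algebraMap _ C.FunctionField a + algebraMap _ _ b * C.y) *
      C.involution (algebraMap _ _ a + algebraMap _ _ b * C.y) =
    algebraMap _ _ (a ^ 2 - b ^ 2 * algebraMap K[X] (RatFunc K) C.f) := by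
  have h := C.y_sq
  rw [IsScalarTower.algebraMap_apply K[X] (RatFunc K)] at h
  simp only [map_add, map_mul, involution_algebraMap, involution_y, map_sub, map_pow]
  linear_combination -(algebraMap (RatFunc K) C.FunctionField b) ^ 2 * h

theorem isSeparable (h2 : (2 : K) ≠ 0) : Algebra.IsSeparable (RatFunc K) C.FunctionField := by
  have h2' : ((2 : ℕ) : RatFunc K) ≠ 0 := by
    rw [Nat.cast_ofNat, ← map_ofNat (algebraMap K (RatFunc K)) 2]
    exact (map_ne_zero (algebraMap K (RatFunc K))).2 h2
  have hsep : C.equation.Separable := by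
    refine separable_X_pow_sub_C _ h2' ?_
    rw [Ne, map_eq_zero_iff _ (RatFunc.algebraMap_injective K)]
    exact C.monic.ne_zero
  have hy : IsSeparable (RatFunc K) C.y :=
    hsep.of_dvd (minpoly.dvd _ _ (by
      rw [aeval_def]
      exact AdjoinRoot.eval₂_root C.equation))
  refine ⟨fun u => ?_⟩
  obtain ⟨a, b, rfl⟩ := C.exists_eq_add_mul_y u
  exact Field.isSeparable_add (isSeparable_algebraMap a)
    (Field.isSeparable_mul (isSeparable_algebraMap b) hy)

end Field

end HyperellipticCurve

/-! ### Places of the curve above primes of K[x] and above infinity -/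

namespace HyperellipticCurve

variable {K : Type*} [Field K] {g : ℕ} (C : HyperellipticCurve K g)

section Places

/-- The function `x` on the curve. -/
def x : C.FunctionField := algebraMap K[X] C.FunctionField X

theorem polynomial_ne_zero {p : K[X]} (hp : p ≠ 0) : algebraMap K[X] C.FunctionField p ≠ 0 := by
  rwa [Ne, map_eq_zero_iff _ C.algebraMap_polynomial_injective]

theorem x_ne_zero : C.x ≠ 0 := C.polynomial_ne_zero X_ne_zero

theorem algebraMap_C (c : K) :
    algebraMap K[X] C.FunctionField (Polynomial.C c) = algebraMap K C.FunctionField c := by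
  rw [IsScalarTower.algebraMap_apply K K[X] C.FunctionField, algebraMap_eq]

variable {C}
variable (P : CurvePoint K C.FunctionField)

theorem polynomial_mem_localRing (hP : 0 ≤ P.ord C.x) (p : K[X]) :
    algebraMap K[X] C.FunctionField p ∈ P.localRing := by
  have hx : C.x ∈ P.localRing := (P.ord_nonneg_iff C.x_ne_zero).1 hP
  induction p using Polynomial.induction_on' with
  | add p q hp hq => rw [map_add]; exact add_mem hp hq
  | monomial n c =>
    rw [← C_mul_X_pow_eq_monomial, map_mul, map_pow, algebraMap_C]
    exact mul_mem (P.algebraMap_mem c) (pow_mem hx n)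

theorem ord_polynomial_nonneg (hP : 0 ≤ P.ord C.x) {p : K[X]} (hp : p ≠ 0) :
    0 ≤ P.ord (algebraMap K[X] C.FunctionField p) :=
  (P.ord_nonneg_iff (C.polynomial_ne_zero hp)).2 (polynomial_mem_localRing P hP p)

theorem ord_C {c : K} (hc : c ≠ 0) :
    P.ord (algebraMap K[X] C.FunctionField (Polynomial.C c)) = 0 := by
  rw [algebraMap_C, P.ord_algebraMap hc]

/-- At a pole of x the leading term dominates. The induction peels off the constant term through p =
X·`p.divX` + p(0). -/
theorem ord_polynomial_of_neg (hP : P.ord C.x < 0) {p : K[X]} (hp : p ≠ 0) :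
    P.ord (algebraMap K[X] C.FunctionField p) = p.natDegree * P.ord C.x := by
  induction hn : p.natDegree generalizing p with
  | zero =>
    obtain ⟨c, rfl⟩ := natDegree_eq_zero.1 hn
    rw [ord_C P (by simpa using hp)]
    simp
  | succ n ih =>
    have h1 : p.divX.natDegree = n := by
      rw [natDegree_divX_eq_natDegree_tsub_one, hn, Nat.add_sub_cancel]
    have h2 : p.divX ≠ 0 := by
      intro h
      have h3 := divX_mul_X_add p
      rw [h, zero_mul, zero_add] at h3
      rw [← h3, natDegree_C] at hn
      omega
    have h3 : P.ord (algebraMap K[X] C.FunctionField (p.divX * X)) = (n + 1) * P.ord C.x := by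
      rw [map_mul, P.ord_mul (C.polynomial_ne_zero h2) (C.polynomial_ne_zero X_ne_zero), ih h2 h1]
      change _ + P.ord C.x = _
      ring
    push_cast
    rw [← h3]
    nth_rw 1 [← divX_mul_X_add p]
    by_cases hc : p.coeff 0 = 0
    · simp [hc]
    rw [map_add]
    refine P.ord_add_of_lt (C.polynomial_ne_zero (mul_ne_zero h2 X_ne_zero))
      (C.polynomial_ne_zero (by simpa using hc)) ?_
    rw [ord_C P hc, h3]
    nlinarith

theorem ord_eq_zero_of_isCoprime (hP : 0 ≤ P.ord C.x) {p q : K[X]} (hpq : IsCoprime p q)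
    (hp : 0 < P.ord (algebraMap K[X] C.FunctionField p)) (hp0 : p ≠ 0) (hq0 : q ≠ 0) :
    P.ord (algebraMap K[X] C.FunctionField q) = 0 := by
  refine le_antisymm ?_ (ord_polynomial_nonneg P hP hq0)
  by_contra hq
  rw [not_le] at hq
  obtain ⟨a, b, hab⟩ := hpq
  have key : ∀ a p : K[X], p ≠ 0 → a * p ≠ 0 → 0 < P.ord (algebraMap K[X] C.FunctionField p) →
      1 ≤ P.ord (algebraMap K[X] C.FunctionField (a * p)) := by
    intro a p hp0 hap h
    have ha : a ≠ 0 := left_ne_zero_of_mul hap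
    rw [map_mul, P.ord_mul (C.polynomial_ne_zero ha) (C.polynomial_ne_zero hp0)]
    have := ord_polynomial_nonneg P hP ha
    omega
  have hone : P.ord (algebraMap K[X] C.FunctionField (a * p + b * q)) = 0 := by
    rw [hab, map_one, P.ord_one]
  -- The order of 0 is 0 by convention, so a vanishing summand in the Bézout relation has to be
  -- treated apart.
  by_cases ha : a * p = 0
  · have hb : b * q ≠ 0 := by
      intro hb
      rw [ha, hb, add_zero] at hab
      exact zero_ne_one hab
    have := key b q hq0 hb hq
    rw [ha, zero_add] at hone
    omega
  by_cases hb : b * q = 0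
  · have := key a p hp0 ha hp
    rw [hb, add_zero] at hone
    omega
  have := P.le_ord_add (key a p hp0 ha hp) (key b q hq0 hb hq) (C.polynomial_ne_zero ha)
    (C.polynomial_ne_zero hb) (by
      rw [← map_add]
      exact C.polynomial_ne_zero (by rw [hab]; exact one_ne_zero))
  rw [← map_add] at this
  omega

theorem two_mul_ord_y : 2 * P.ord C.y = P.ord (algebraMap K[X] C.FunctionField C.f) := by
  rw [← C.y_sq, P.ord_pow]
  simp

variable (C)

theorem exists_finset_above_prime (h2 : (2 : K) ≠ 0) {p : K[X]} (hp : Prime p) :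
    ∃ T : Finset (CurvePoint K C.FunctionField),
      (∀ P, P ∈ T ↔ 0 ≤ P.ord C.x ∧ 0 < P.ord (algebraMap K[X] C.FunctionField p)) ∧
      ∑ P ∈ T, P.ord (algebraMap K[X] C.FunctionField p) * P.degree = 2 * p.natDegree ∧
      ∀ P ∈ T, (∀ r : RatFunc K, P.ord (algebraMap K[X] C.FunctionField p) ∣
        P.ord (algebraMap _ C.FunctionField r)) ∧
        ∃ k : ℕ, 0 < k ∧ P.degree = k * p.natDegree := by
  have := C.isSeparable h2
  obtain ⟨T, hT, hsum, hT'⟩ :=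
    CurvePoint.exists_finset_sum_ord_mul_degree K (RatFunc K) C.FunctionField hp
  rw [finrank_functionField, finrank_quotient_span_eq_natDegree] at hsum
  rw [finrank_quotient_span_eq_natDegree] at hT'
  refine ⟨T, fun P => ?_, hsum, hT'⟩
  rw [hT]
  refine and_congr ⟨fun h => ?_, fun h => polynomial_mem_localRing P h⟩ Iff.rfl
  exact (P.ord_nonneg_iff C.x_ne_zero).2 (h X)

/-- This is the fundamental identity for the uniformizer 1/X of K(x) at infinity; -ord(x) is the
ramification index. -/
theorem exists_finset_infinite (h2 : (2 : K) ≠ 0) :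
    ∃ T : Finset (CurvePoint K C.FunctionField),
      (∀ P, P ∈ T ↔ P.ord C.x < 0) ∧
      ∑ P ∈ T, -P.ord C.x * P.degree = 2 ∧
      ∀ P ∈ T, (∀ r : RatFunc K, -P.ord C.x ∣ P.ord (algebraMap _ C.FunctionField r)) ∧
        0 < P.degree := by
  classical
  have := C.isSeparable h2
  let A := (RatFunc.inftyPoint K).localRing
  have hsc : IsScalarTower K A C.FunctionField := IsScalarTower.of_algebraMap_eq fun _ => rfl
  obtain ⟨T, hT, hsum, hT'⟩ :=
    CurvePoint.exists_finset_sum_ord_mul_degree K (RatFunc K) C.FunctionField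
      (RatFunc.inftyUniformizer_prime (K := K))
  rw [finrank_functionField, RatFunc.finrank_quotient_inftyUniformizer] at hsum
  rw [RatFunc.finrank_quotient_inftyUniformizer] at hT'
  have hx : algebraMap A C.FunctionField (RatFunc.inftyUniformizer K) = C.x⁻¹ := by
    change algebraMap (RatFunc K) C.FunctionField (RatFunc.X)⁻¹ = C.x⁻¹
    rw [map_inv₀, ← RatFunc.algebraMap_X, ← IsScalarTower.algebraMap_apply]
    rfl
  have hx' : ∀ P : CurvePoint K C.FunctionField,
      P.ord (algebraMap A C.FunctionField (RatFunc.inftyUniformizer K)) = -P.ord C.x := fun P => by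
    rw [hx, P.ord_inv]
  simp only [A, hx'] at hT hsum hT'
  refine ⟨T, fun P => ?_, by simpa using hsum, fun P hP => ?_⟩
  · rw [hT]
    refine ⟨fun h => by omega, fun h => ⟨?_, by omega⟩⟩
    rintro ⟨r, hr⟩
    change algebraMap (RatFunc K) C.FunctionField r ∈ P.localRing
    by_cases hr0 : r = 0
    · simp [hr0]
    have hr1 : algebraMap (RatFunc K) C.FunctionField r ≠ 0 := by simpa using hr0
    have hn0 : r.num ≠ 0 := RatFunc.num_ne_zero hr0
    rw [← P.ord_nonneg_iff hr1]
    rw [RatFunc.mem_inftyPoint, RatFunc.inftyValuation_apply,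
      RatFunc.inftyValuation_of_nonzero K hr0, ← WithZero.log_le_log
      WithZero.exp_ne_zero one_ne_zero, WithZero.log_exp, WithZero.log_one, RatFunc.intDegree] at hr
    rw [← RatFunc.num_div_denom r, map_div₀, ← IsScalarTower.algebraMap_apply,
      ← IsScalarTower.algebraMap_apply, P.ord_div (C.polynomial_ne_zero hn0)
        (C.polynomial_ne_zero r.denom_ne_zero), ord_polynomial_of_neg P h hn0,
        ord_polynomial_of_neg P h r.denom_ne_zero]
    nlinarith
  · obtain ⟨h1, k, hk, hk'⟩ := hT' P hP
    exact ⟨h1, by omega⟩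

theorem ord_comap_involution_polynomial (P : CurvePoint K C.FunctionField) (p : K[X]) :
    (P.comap C.involution).ord (algebraMap _ _ p) = P.ord (algebraMap _ _ p) := by
  rw [P.ord_comap, involution_polynomial]

variable {C}

/-- Write a uniformizer as t = a + b y. Since P is σ-stable, the trace 2a has order ≥ 1, hence ≥ 2
if e ≠ 1. Then b y = t - a has order exactly 1, which e cannot divide. This excludes ramification at
σ-stable places where e divides the order of y. -/
theorem ramification_eq_one (h2 : (2 : K) ≠ 0) (P : CurvePoint K C.FunctionField)
    (hP : P.comap C.involution = P) {e : ℤ} (he : 0 < e)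
    (hr : ∀ r : RatFunc K, e ∣ P.ord (algebraMap _ C.FunctionField r)) (hy : e ∣ P.ord C.y) :
    e = 1 := by
  have hdvd : ∀ n : ℤ, 1 ≤ n → e ∣ n → ¬ e = 1 → 2 ≤ n := fun n hn h he1 => by
    have := Int.le_of_dvd (by omega) h
    omega
  by_contra he1
  obtain ⟨t, ht0, ht⟩ := P.exists_ord_eq_one
  have ht' : P.ord (C.involution t) = 1 := by rw [← P.ord_comap, hP, ht]
  have ht0' : C.involution t ≠ 0 := by simpa using ht0
  obtain ⟨a, b, hab⟩ := C.exists_eq_add_mul_y t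
  have h2F : algebraMap K C.FunctionField 2 ≠ 0 := by simpa using h2
  have hsum : t + C.involution t = algebraMap K C.FunctionField 2 * algebraMap _ _ a := by
    rw [hab, map_add, map_mul, involution_algebraMap, involution_algebraMap, involution_y,
      map_ofNat]
    ring
  have hby : b ≠ 0 → e ∣ P.ord (algebraMap _ C.FunctionField b * C.y) := fun hb => by
    rw [P.ord_mul (by simpa using hb) C.y_ne_zero]
    exact dvd_add (hr b) hy
  by_cases ha : a = 0
  · by_cases hb : b = 0
    · rw [ha, hb] at hab
      simp [hab] at ht0
    · have := hby hb
      rw [ha, map_zero, zero_add] at hab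
      rw [← hab, ht] at this
      exact he1 (Int.eq_one_of_dvd_one he.le this)
  · have ha' : algebraMap _ C.FunctionField a ≠ 0 := by simpa using ha
    have h3 := P.le_ord_add ht.ge ht'.ge ht0 ht0' (by rw [hsum]; exact mul_ne_zero h2F ha')
    rw [hsum, P.ord_mul h2F ha', P.ord_algebraMap h2, zero_add] at h3
    have h4 := hdvd _ h3 (hr a) he1
    by_cases hb : b = 0
    · rw [hb, map_zero, zero_mul, add_zero] at hab
      rw [← hab, ht] at h4
      omega
    have hb' : algebraMap _ C.FunctionField b * C.y ≠ 0 :=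
      mul_ne_zero (by simpa using hb) C.y_ne_zero
    have h5 : algebraMap _ C.FunctionField b * C.y = t + -algebraMap _ _ a := by
      rw [hab]; ring
    have h6 : P.ord (algebraMap _ C.FunctionField b * C.y) = 1 := by
      rw [h5, P.ord_add_of_lt ht0 (neg_ne_zero.2 ha') (by rw [P.ord_neg]; omega), ht]
    have := hdvd _ h6.ge (hby hb) he1
    omega

/-- Bounds for positive weights whose weighted sum of degrees is twice `d`, all degrees being
multiples of `d`. -/
theorem weight_bounds {T : Finset (CurvePoint K C.FunctionField)}
    {e : CurvePoint K C.FunctionField → ℤ} {d : ℕ} (hd : 0 < d)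
    (hsum : ∑ P ∈ T, e P * P.degree = 2 * d) (he : ∀ P ∈ T, 0 < e P)
    (hdeg : ∀ P ∈ T, ∃ k : ℕ, 0 < k ∧ P.degree = k * d) :
    T.Nonempty ∧ (∀ P ∈ T, e P ≤ 2) ∧ ∀ P ∈ T, ∀ Q ∈ T, P ≠ Q → e P = 1 := by
  classical
  have hle : ∀ P ∈ T, e P * d ≤ e P * P.degree := fun P hP => by
    obtain ⟨k, hk, hk'⟩ := hdeg P hP
    refine mul_le_mul_of_nonneg_left ?_ (he P hP).le
    rw [hk']
    exact_mod_cast Nat.le_mul_of_pos_left d hk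
  have hnn : ∀ P ∈ T, 0 ≤ e P * P.degree := fun P hP => by
    have := he P hP
    positivity
  have hd' : (0 : ℤ) < d := by exact_mod_cast hd
  refine ⟨?_, fun P hP => ?_, fun P hP Q hQ hPQ => ?_⟩
  · rw [Finset.nonempty_iff_ne_empty]
    rintro rfl
    rw [Finset.sum_empty] at hsum
    omega
  · have h1 := Finset.single_le_sum hnn hP
    rw [hsum] at h1
    have h3 := hle P hP
    exact le_of_mul_le_mul_right (h3.trans h1) hd'
  · have h1 : ∑ R ∈ {P, Q}, e R * R.degree ≤ ∑ R ∈ T, e R * R.degree :=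
      Finset.sum_le_sum_of_subset_of_nonneg (by
        intro R hR
        rcases Finset.mem_insert.1 hR with rfl | hR
        · exact hP
        · rw [Finset.mem_singleton.1 hR]; exact hQ) (fun R hR _ => hnn R hR)
    rw [Finset.sum_pair hPQ, hsum] at h1
    have h3 := hle P hP
    have h4 := hle Q hQ
    have h5 : (e P + e Q) * d ≤ 2 * d := by linarith
    have h6 := le_of_mul_le_mul_right h5 hd'
    have := he P hP
    have := he Q hQ
    omega

variable (C)

/-- If σ moves P, there are two places above p and `weight_bounds` gives index 1. If σ fixes P, then
y has order 0 there because p ∤ f, and `ramification_eq_one` applies. -/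
theorem exists_unramified (h2 : (2 : K) ≠ 0) {p : K[X]} (hp : Prime p) (hpf : ¬ p ∣ C.f) :
    ∃ P : CurvePoint K C.FunctionField,
      0 ≤ P.ord C.x ∧ P.ord (algebraMap K[X] C.FunctionField p) = 1 := by
  obtain ⟨T, hT, hsum, hT'⟩ := C.exists_finset_above_prime h2 hp
  have hpos : ∀ P ∈ T, 0 < P.ord (algebraMap K[X] C.FunctionField p) := fun P hP => ((hT P).1 hP).2
  obtain ⟨⟨P, hP⟩, -, hone⟩ := weight_bounds hp.irreducible.natDegree_pos hsum hpos
    fun P hP => (hT' P hP).2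
  have hx := ((hT P).1 hP).1
  refine ⟨P, hx, ?_⟩
  by_cases hσ : P.comap C.involution = P
  · refine ramification_eq_one h2 P hσ (hpos P hP) (hT' P hP).1 ?_
    have h1 := ord_eq_zero_of_isCoprime P hx ((hp.irreducible.coprime_iff_not_dvd).2 hpf)
      (hpos P hP) hp.ne_zero C.monic.ne_zero
    have h3 := two_mul_ord_y P
    rw [h1] at h3
    have h4 : P.ord C.y = 0 := by omega
    rw [h4]
    exact dvd_zero _
  · refine hone P hP _ ((hT _).2 ?_) (Ne.symm hσ)
    rw [x, ord_comap_involution_polynomial, ord_comap_involution_polynomial]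
    exact (hT P).1 hP

/-- As p divides f exactly once, 2·ord(y) = ord(p), so the index is even, hence 2. No other place
then fits above p, so σ fixes P. -/
theorem exists_ramified (h2 : (2 : K) ≠ 0) {p : K[X]} (hp : Prime p) (hpf : p ∣ C.f) :
    ∃ P : CurvePoint K C.FunctionField, 0 ≤ P.ord C.x ∧
      P.ord (algebraMap K[X] C.FunctionField p) = 2 ∧ P.comap C.involution = P ∧
      ∀ r : RatFunc K, 2 ∣ P.ord (algebraMap _ C.FunctionField r) := by
  obtain ⟨T, hT, hsum, hT'⟩ := C.exists_finset_above_prime h2 hp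
  have hpos : ∀ P ∈ T, 0 < P.ord (algebraMap K[X] C.FunctionField p) := fun P hP => ((hT P).1 hP).2
  obtain ⟨⟨P, hP⟩, htwo, hone⟩ := weight_bounds hp.irreducible.natDegree_pos hsum hpos
    fun P hP => (hT' P hP).2
  have hx := ((hT P).1 hP).1
  obtain ⟨q, hq⟩ := hpf
  have hq0 : q ≠ 0 := by
    rintro rfl
    rw [mul_zero] at hq
    exact C.monic.ne_zero hq
  have hpq : ¬ p ∣ q := by
    rintro ⟨r, rfl⟩
    exact hp.not_isUnit (C.separable.squarefree p ⟨r, by rw [hq]; ring⟩)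
  have h1 := ord_eq_zero_of_isCoprime P hx ((hp.irreducible.coprime_iff_not_dvd).2 hpq)
      (hpos P hP) hp.ne_zero hq0
  have h3 := two_mul_ord_y P
  rw [hq, map_mul, P.ord_mul (C.polynomial_ne_zero hp.ne_zero) (C.polynomial_ne_zero hq0), h1] at h3
  have h4 := htwo P hP
  have h5 := hpos P hP
  have h6 : P.ord (algebraMap K[X] C.FunctionField p) = 2 := by omega
  refine ⟨P, hx, h6, ?_, fun r => h6 ▸ (hT' P hP).1 r⟩
  by_contra hσ
  have := hone P hP _ ((hT (P.comap C.involution)).2 (by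
    rw [x, ord_comap_involution_polynomial, ord_comap_involution_polynomial]
    exact (hT P).1 hP)) (Ne.symm hσ)
  omega

theorem exists_infinite (h2 : (2 : K) ≠ 0) :
    ∃ P : CurvePoint K C.FunctionField, P.ord C.x = -1 := by
  obtain ⟨T, hT, hsum, hT'⟩ := C.exists_finset_infinite h2
  have hpos : ∀ P ∈ T, 0 < -P.ord C.x := fun P hP => by
    have := (hT P).1 hP
    omega
  obtain ⟨⟨P, hP⟩, -, hone⟩ := weight_bounds (e := fun P => -P.ord C.x) one_pos
    (by simpa using hsum) hpos fun P hP => ⟨P.degree, (hT' P hP).2, by simp⟩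
  refine ⟨P, ?_⟩
  suffices -P.ord C.x = 1 by omega
  by_cases hσ : P.comap C.involution = P
  · refine ramification_eq_one h2 P hσ (hpos P hP) (hT' P hP).1 ?_
    have h3 := two_mul_ord_y P
    rw [ord_polynomial_of_neg P ((hT P).1 hP) C.monic.ne_zero, C.natDegree_eq] at h3
    push_cast at h3
    -- The degree of f is even, so the order of y is a multiple of the ramification index -ord(x).
    have h4 : P.ord C.y = -P.ord C.x * (-(g + 1)) := by linarith
    rw [h4]
    exact dvd_mul_right _ _
  · refine hone P hP _ ((hT _).2 ?_) (Ne.symm hσ)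
    rw [x, ord_comap_involution_polynomial]
    exact (hT P).1 hP

end Places

end HyperellipticCurve

/-! ### Principal divisors have degree zero -/

namespace CurveDivisor

variable {K F : Type*} [Field K] [Field F] [Algebra K F]

theorem degree_apply (D : CurveDivisor K F) : degree K F D = D.sum fun P n => n * P.degree := rfl

/-- `u` has a divisor, and its degree is zero. -/
def HasDegreeZeroDiv (K : Type*) {F : Type*} [Field K] [Field F] [Algebra K F] (u : F) : Prop :=
  ∃ D : CurveDivisor K F, IsDivOf D u ∧ degree K F D = 0

theorem HasDegreeZeroDiv.mul {u v : F} (hu : HasDegreeZeroDiv K u) (hv : HasDegreeZeroDiv K v) :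
    HasDegreeZeroDiv K (u * v) := by
  obtain ⟨D, ⟨hu0, hD⟩, hD'⟩ := hu
  obtain ⟨E, ⟨hv0, hE⟩, hE'⟩ := hv
  exact ⟨D + E, ⟨mul_ne_zero hu0 hv0, fun P => by
    rw [Finsupp.add_apply, hD, hE, P.ord_mul hu0 hv0]⟩, by rw [map_add, hD', hE', add_zero]⟩

theorem HasDegreeZeroDiv.inv {u : F} (hu : HasDegreeZeroDiv K u) : HasDegreeZeroDiv K u⁻¹ := by
  obtain ⟨D, ⟨hu0, hD⟩, hD'⟩ := hu
  exact ⟨-D, ⟨inv_ne_zero hu0, fun P => by rw [Finsupp.neg_apply, hD, P.ord_inv]⟩, by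
    rw [map_neg, hD', neg_zero]⟩

theorem hasDegreeZeroDiv_of_ord_eq_zero {u : F} (hu : u ≠ 0)
    (h : ∀ P : CurvePoint K F, P.ord u = 0) :
    HasDegreeZeroDiv K u :=
  ⟨0, ⟨hu, fun P => by rw [h]; rfl⟩, map_zero _⟩

theorem degree_eq_sum (D : CurveDivisor K F) {T : Finset (CurvePoint K F)}
    (hT : ∀ P, D P ≠ 0 → P ∈ T) : degree K F D = ∑ P ∈ T, D P * P.degree := by
  rw [degree_apply]
  exact Finsupp.sum_of_support_subset _ (fun P hP => hT P (Finsupp.mem_support_iff.1 hP)) _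
    fun P _ => zero_mul _

theorem exists_comap_involutive (D : CurveDivisor K F) {σ : F ≃ₐ[K] F} (hσ : ∀ u, σ (σ u) = u) :
    ∃ E : CurveDivisor K F, (∀ P, E P = D (P.comap σ)) ∧ degree K F E = degree K F D := by
  have hinv : Function.Involutive fun P : CurvePoint K F => P.comap σ := fun P =>
    CurvePoint.ext_localRing (by
      ext u
      rw [CurvePoint.mem_comap_localRing, CurvePoint.mem_comap_localRing, hσ])
  refine ⟨Finsupp.mapDomain (fun P => P.comap σ) D, fun P => ?_, ?_⟩
  · conv_lhs => rw [← hinv P]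
    exact Finsupp.mapDomain_apply hinv.injective D _
  · rw [degree_apply, degree_apply, Finsupp.sum_mapDomain_index_inj hinv.injective]
    exact Finsupp.sum_congr fun P _ => by rw [P.degree_comap σ]

end CurveDivisor

namespace HyperellipticCurve

open CurveDivisor

variable {K : Type*} [Field K] {g : ℕ} (C : HyperellipticCurve K g)

/-- The zeros lie above p and contribute 2·deg p; the poles lie above infinity and contribute -2·deg
p. -/
theorem hasDegreeZeroDiv_prime (h2 : (2 : K) ≠ 0) {p : K[X]} (hp : Prime p) :
    HasDegreeZeroDiv K (algebraMap K[X] C.FunctionField p) := by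
  classical
  obtain ⟨T, hT, hsum, -⟩ := C.exists_finset_above_prime h2 hp
  obtain ⟨T', hT', hsum', -⟩ := C.exists_finset_infinite h2
  have hmem : ∀ P : CurvePoint K C.FunctionField,
      P.ord (algebraMap K[X] C.FunctionField p) ≠ 0 → P ∈ T ∪ T' := by
    intro P hP
    rw [Finset.mem_union, hT, hT']
    by_cases hx : P.ord C.x < 0
    · exact Or.inr hx
    · have := ord_polynomial_nonneg P (not_lt.1 hx) hp.ne_zero
      exact Or.inl ⟨not_lt.1 hx, by omega⟩
  let D : CurveDivisor K C.FunctionField := Finsupp.onFinset (T ∪ T') _ hmem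
  have hD : ∀ P, D P = P.ord (algebraMap K[X] C.FunctionField p) := fun P => rfl
  refine ⟨D, ⟨C.polynomial_ne_zero hp.ne_zero, hD⟩, ?_⟩
  rw [degree_eq_sum D (T := T ∪ T') (fun P hP => hmem P (by rwa [← hD])), Finset.sum_union]
  · have h1 : ∑ P ∈ T', D P * P.degree = p.natDegree * -∑ P ∈ T', -P.ord C.x * P.degree := by
      rw [← Finset.sum_neg_distrib, Finset.mul_sum]
      refine Finset.sum_congr rfl fun P hP => ?_
      rw [hD, ord_polynomial_of_neg P ((hT' P).1 hP) hp.ne_zero]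
      ring
    have h3 : ∑ P ∈ T, D P * P.degree = 2 * p.natDegree := hsum
    rw [h1, hsum', h3]
    ring
  · rw [Finset.disjoint_left]
    intro P hP hP'
    have h1 := ((hT P).1 hP).1
    have h3 := (hT' P).1 hP'
    omega

theorem hasDegreeZeroDiv_polynomial (h2 : (2 : K) ≠ 0) {p : K[X]} (hp : p ≠ 0) :
    HasDegreeZeroDiv K (algebraMap K[X] C.FunctionField p) := by
  induction p using UniqueFactorizationMonoid.induction_on_prime with
  | h₁ => exact absurd rfl hp
  | h₂ u hu =>
    obtain ⟨c, hc, rfl⟩ := isUnit_iff.1 hu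
    exact hasDegreeZeroDiv_of_ord_eq_zero (C.polynomial_ne_zero hp) fun P => ord_C P hc.ne_zero
  | h₃ a q ha hq ih =>
    rw [map_mul]
    exact (C.hasDegreeZeroDiv_prime h2 hq).mul (ih ha)

theorem hasDegreeZeroDiv_ratFunc (h2 : (2 : K) ≠ 0) {r : RatFunc K} (hr : r ≠ 0) :
    HasDegreeZeroDiv K (algebraMap _ C.FunctionField r) := by
  rw [← RatFunc.num_div_denom r, map_div₀, ← IsScalarTower.algebraMap_apply,
    ← IsScalarTower.algebraMap_apply, div_eq_mul_inv]
  exact (C.hasDegreeZeroDiv_polynomial h2 (RatFunc.num_ne_zero hr)).mul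
    (C.hasDegreeZeroDiv_polynomial h2 r.denom_ne_zero).inv

theorem add_involution (a b : RatFunc K) :
    (algebraMap _ C.FunctionField a + algebraMap _ _ b * C.y) +
      C.involution (algebraMap _ _ a + algebraMap _ _ b * C.y) = algebraMap _ _ (2 * a) := by
  simp only [map_add, map_mul, involution_algebraMap, involution_y, map_ofNat]
  ring

/-- Every nonzero function on the curve has a divisor, of degree zero. -/
theorem hasDegreeZeroDiv (h2 : (2 : K) ≠ 0) {u : C.FunctionField} (hu : u ≠ 0) :
    HasDegreeZeroDiv K u := by
  classical
  obtain ⟨a, b, hab⟩ := C.exists_eq_add_mul_y u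
  have htr := C.add_involution a b
  have hnm := C.mul_involution a b
  rw [← hab] at htr hnm
  set s := 2 * a with hs
  set n := a ^ 2 - b ^ 2 * algebraMap K[X] (RatFunc K) C.f with hn
  have hσ : C.involution u ≠ 0 := by simpa using hu
  have hn0 : n ≠ 0 := by
    intro h
    rw [h, map_zero] at hnm
    exact mul_ne_zero hu hσ hnm
  obtain ⟨N, ⟨-, hN⟩, hN'⟩ := C.hasDegreeZeroDiv_ratFunc h2 hn0
  obtain ⟨S, hS⟩ : ∃ S : Finset (CurvePoint K C.FunctionField),
      s ≠ 0 → ∀ P, P.ord (algebraMap _ C.FunctionField s) ≠ 0 → P ∈ S := by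
    by_cases hs0 : s = 0
    · exact ⟨∅, fun h => absurd hs0 h⟩
    · obtain ⟨S, ⟨-, hS⟩, -⟩ := C.hasDegreeZeroDiv_ratFunc h2 hs0
      exact ⟨S.support, fun _ P hP => by rwa [Finsupp.mem_support_iff, hS]⟩
  -- Finite support: if N(u) has order 0 at P but u does not, then u and σ(u) have opposite nonzero
  -- orders, so the trace s has the negative one and P lies in the support of its divisor.
  have hsupp : ∀ P : CurvePoint K C.FunctionField, P.ord u ≠ 0 → P ∈ N.support ∪ S := by
    intro P hP
    rw [Finset.mem_union, Finsupp.mem_support_iff, hN]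
    by_contra hcon
    rw [not_or, not_not] at hcon
    obtain ⟨h1, h3⟩ := hcon
    rw [← hnm, P.ord_mul hu hσ] at h1
    have h4 : P.ord (algebraMap _ C.FunctionField s) ≠ 0 ∧ s ≠ 0 := by
      rcases lt_or_gt_of_ne hP with hlt | hgt
      · have h5 := P.ord_add_of_lt hu hσ (by omega)
        rw [htr] at h5
        refine ⟨by omega, ?_⟩
        rintro h0
        rw [h0, map_zero] at h5
        rw [P.ord_zero] at h5
        omega
      · have h5 := P.ord_add_of_lt hσ hu (by omega)
        rw [add_comm, htr] at h5
        refine ⟨by omega, ?_⟩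
        rintro h0
        rw [h0, map_zero] at h5
        rw [P.ord_zero] at h5
        omega
    exact h3 (hS h4.2 P h4.1)
  let D : CurveDivisor K C.FunctionField := Finsupp.onFinset _ _ hsupp
  have hD : ∀ P, D P = P.ord u := fun P => rfl
  obtain ⟨D', hD', hDD'⟩ := exists_comap_involutive D C.involution_involution
  -- The divisor of u plus its conjugate is that of the norm, and conjugation preserves degree;
  -- hence 2·deg D = 0.
  have hadd : D + D' = N := by
    ext P
    rw [Finsupp.add_apply, hD', hD, hD, hN, ← hnm, P.ord_mul hu hσ, P.ord_comap]
  have h0 := congrArg (degree K C.FunctionField) hadd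
  rw [map_add, hDD', hN'] at h0
  exact ⟨D, ⟨hu, hD⟩, by omega⟩

end HyperellipticCurve

namespace Polynomial

/-! ### Norm forms over K[x] from the quadratic extension K(√ε) -/

section QuadraticExtension

variable {K : Type*} [Field K] {ε : K}

/-- The polynomial `A + √ε B` over the quadratic extension `K(√ε)`. -/
def addOmegaMul (ε : K) (A B : K[X]) : (QuadraticAlgebra K ε 0)[X] :=
  A.map (algebraMap K _) + C QuadraticAlgebra.omega * B.map (algebraMap K _)

theorem coeff_addOmegaMul (A B : K[X]) (n : ℕ) :
    (addOmegaMul ε A B).coeff n = ⟨A.coeff n, B.coeff n⟩ := by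
  rw [addOmegaMul, coeff_add, coeff_C_mul, coeff_map, coeff_map]
  ext <;> simp

theorem addOmegaMul_inj {A B A' B' : K[X]} :
    addOmegaMul ε A B = addOmegaMul ε A' B' ↔ A = A' ∧ B = B' := by
  refine ⟨fun h => ?_, fun ⟨h, h'⟩ => by rw [h, h']⟩
  have hc : ∀ n, A.coeff n = A'.coeff n ∧ B.coeff n = B'.coeff n := fun n => by
    have := congrArg (coeff · n) h
    simpa [coeff_addOmegaMul] using this
  exact ⟨Polynomial.ext fun n => (hc n).1, Polynomial.ext fun n => (hc n).2⟩

theorem addOmegaMul_mul (A B A' B' : K[X]) :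
    addOmegaMul ε A B * addOmegaMul ε A' B' =
      addOmegaMul ε (A * A' + C ε * (B * B')) (A * B' + B * A') := by
  have hω : (C QuadraticAlgebra.omega : (QuadraticAlgebra K ε 0)[X]) * C QuadraticAlgebra.omega =
      (C ε).map (algebraMap K _) := by
    rw [← C_mul, map_C, QuadraticAlgebra.omega_mul_omega_eq_mk]
    rfl
  simp only [addOmegaMul, Polynomial.map_add, Polynomial.map_mul]
  linear_combination (B.map (algebraMap K _)) * (B'.map (algebraMap K _)) * hω

theorem map_eq_addOmegaMul (A : K[X]) :
    A.map (algebraMap K (QuadraticAlgebra K ε 0)) = addOmegaMul ε A 0 := by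
  simp [addOmegaMul]

theorem exists_eq_addOmegaMul (p : (QuadraticAlgebra K ε 0)[X]) :
    ∃ A B : K[X], p = addOmegaMul ε A B := by
  induction p using Polynomial.induction_on' with
  | add p q hp hq =>
    obtain ⟨A, B, rfl⟩ := hp
    obtain ⟨A', B', rfl⟩ := hq
    refine ⟨A + A', B + B', ?_⟩
    simp only [addOmegaMul, Polynomial.map_add]
    ring
  | monomial n c =>
    refine ⟨monomial n c.re, monomial n c.im, Polynomial.ext fun k => ?_⟩
    rw [coeff_addOmegaMul, coeff_monomial, coeff_monomial, coeff_monomial]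
    split_ifs <;> rfl

/-- Coefficientwise conjugation over `K(√ε)`. -/
def quadConj (ε : K) : (QuadraticAlgebra K ε 0)[X] →+* (QuadraticAlgebra K ε 0)[X] :=
  mapRingHom (starRingEnd _)

theorem quadConj_addOmegaMul (A B : K[X]) :
    quadConj ε (addOmegaMul ε A B) = addOmegaMul ε A (-B) := by
  ext n
  all_goals
    rw [quadConj, coe_mapRingHom, coeff_map, coeff_addOmegaMul, coeff_addOmegaMul,
      starRingEnd_apply]
    simp

theorem quadConj_quadConj (p : (QuadraticAlgebra K ε 0)[X]) : quadConj ε (quadConj ε p) = p := by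
  obtain ⟨A, B, rfl⟩ := exists_eq_addOmegaMul p
  rw [quadConj_addOmegaMul, quadConj_addOmegaMul, neg_neg]

theorem quadConj_map (A : K[X]) : quadConj ε (A.map (algebraMap K _)) = A.map (algebraMap K _) := by
  rw [map_eq_addOmegaMul, quadConj_addOmegaMul, neg_zero]

theorem monic_quadConj {p : (QuadraticAlgebra K ε 0)[X]} (hp : p.Monic) :
    (quadConj ε p).Monic := hp.map _

theorem addOmegaMul_mul_quadConj (A B : K[X]) :
    addOmegaMul ε A B * quadConj ε (addOmegaMul ε A B) =
      (A ^ 2 - C ε * B ^ 2).map (algebraMap K _) := by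
  rw [quadConj_addOmegaMul, addOmegaMul_mul, map_eq_addOmegaMul]
  congr 1 <;> ring

theorem monic_and_lt_of_addOmegaMul {A B : K[X]} (h : (addOmegaMul ε A B).Monic) :
    A.Monic ∧ A.natDegree = (addOmegaMul ε A B).natDegree ∧
      ∀ k, (addOmegaMul ε A B).natDegree ≤ k → B.coeff k = 0 := by
  set n := (addOmegaMul ε A B).natDegree with hn
  have h1 : A.coeff n = 1 ∧ B.coeff n = 0 := by
    have := h.coeff_natDegree
    rw [← hn, coeff_addOmegaMul] at this
    exact ⟨congrArg QuadraticAlgebra.re this, congrArg QuadraticAlgebra.im this⟩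
  have h2 : ∀ k, n < k → A.coeff k = 0 ∧ B.coeff k = 0 := fun k hk => by
    have := coeff_eq_zero_of_natDegree_lt (hn ▸ hk)
    rw [coeff_addOmegaMul] at this
    exact ⟨congrArg QuadraticAlgebra.re this, congrArg QuadraticAlgebra.im this⟩
  have hA : A.natDegree ≤ n := natDegree_le_iff_coeff_eq_zero.2 fun k hk => (h2 k hk).1
  have hAn : A.natDegree = n := natDegree_eq_of_le_of_coeff_ne_zero hA (by
    rw [h1.1]; exact one_ne_zero)
  refine ⟨?_, hAn, fun k hk => ?_⟩
  · rw [Monic, leadingCoeff, hAn, h1.1]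
  · rcases hk.eq_or_lt with rfl | hk
    · exact h1.2
    · exact (h2 k hk).2

variable [Fact (∀ r : K, r ^ 2 ≠ ε + 0 * r)]

/-- A monic polynomial over `K` dividing a norm of coprime conjugates is itself a norm. -/
theorem exists_eq_mul_quadConj {α : (QuadraticAlgebra K ε 0)[X]} (hα : IsCoprime α (quadConj ε α))
    {q : K[X]} (hq : q.Monic) (h : q.map (algebraMap K _) ∣ α * quadConj ε α) :
    ∃ d : (QuadraticAlgebra K ε 0)[X], d.Monic ∧ d ∣ α ∧
      q.map (algebraMap K _) = d * quadConj ε d := by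
  obtain ⟨a, b, ha, hb, hab⟩ := exists_dvd_and_dvd_of_dvd_mul h
  have hqm : (q.map (algebraMap K (QuadraticAlgebra K ε 0))).Monic := hq.map _
  have ha0 : a ≠ 0 := by
    rintro rfl
    rw [zero_mul] at hab
    exact hqm.ne_zero hab
  set c := a.leadingCoeff with hc
  have hc0 : c ≠ 0 := leadingCoeff_ne_zero.2 ha0
  set d := a * C c⁻¹ with hd
  set d' := b * C c with hd'
  have hdm : d.Monic := monic_mul_leadingCoeff_inv ha0
  have hdd : q.map (algebraMap K _) = d * d' := by
    have : (C c⁻¹ : (QuadraticAlgebra K ε 0)[X]) * C c = 1 := by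
      rw [← C_mul, inv_mul_cancel₀ hc0, C_1]
    rw [hab, hd, hd']
    linear_combination -(a * b) * this
  have hdm' : d'.Monic := hdm.of_mul_monic_left (hdd ▸ hqm)
  have hdα : d ∣ α := by
    obtain ⟨e, he⟩ := ha
    refine ⟨C c * e, ?_⟩
    have : (C c⁻¹ : (QuadraticAlgebra K ε 0)[X]) * C c = 1 := by
      rw [← C_mul, inv_mul_cancel₀ hc0, C_1]
    rw [he, hd]
    linear_combination -(a * e) * this
  have hdα' : d' ∣ quadConj ε α := by
    obtain ⟨e, he⟩ := hb
    refine ⟨C c⁻¹ * e, ?_⟩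
    have : (C c⁻¹ : (QuadraticAlgebra K ε 0)[X]) * C c = 1 := by
      rw [← C_mul, inv_mul_cancel₀ hc0, C_1]
    rw [he, hd']
    linear_combination -(b * e) * this
  have hconj : d * d' = quadConj ε d * quadConj ε d' := by
    rw [← map_mul, ← hdd, quadConj_map]
  have hc1 : quadConj ε d ∣ quadConj ε α := _root_.map_dvd _ hdα
  have hc2 : quadConj ε d' ∣ α := by
    have := _root_.map_dvd (quadConj ε) hdα'
    rwa [quadConj_quadConj] at this
  -- Since q is fixed by conjugation, d d' equals the product of the conjugates. Coprimality of α
  -- and ᾱ then matches the factors dividing α on each side, namely d and the conjugate of d'.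
  have h1 : quadConj ε d' ∣ d := by
    have hcop : IsCoprime (quadConj ε d') d' :=
      (hα.of_isCoprime_of_dvd_left hc2).of_isCoprime_of_dvd_right hdα'
    exact hcop.dvd_of_dvd_mul_right ⟨quadConj ε d, by rw [hconj]; ring⟩
  have h3 : d ∣ quadConj ε d' := by
    have hcop : IsCoprime d (quadConj ε d) :=
      (hα.of_isCoprime_of_dvd_left hdα).of_isCoprime_of_dvd_right hc1
    exact hcop.dvd_of_dvd_mul_left ⟨d', by rw [hconj]⟩
  have h4 : d = quadConj ε d' :=
    eq_of_monic_of_associated hdm (monic_quadConj hdm') (associated_of_dvd_dvd h3 h1)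
  refine ⟨d, hdm, hdα, ?_⟩
  rw [hdd]
  congr 1
  rw [h4, quadConj_quadConj]

/-- The sum and difference of A ± √ε B are 2A and 2√ε B, and 2ε is invertible, so a Bézout relation
for A and B lifts. -/
theorem isCoprime_addOmegaMul (h2 : (2 : K) ≠ 0) (hε : ε ≠ 0) {A B : K[X]} (h : IsCoprime A B) :
    IsCoprime (addOmegaMul ε A B) (quadConj ε (addOmegaMul ε A B)) := by
  obtain ⟨u, v, huv⟩ := h
  have key : addOmegaMul ε (C 2⁻¹ * u) (C (2 * ε)⁻¹ * v) * addOmegaMul ε A B +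
      addOmegaMul ε (C 2⁻¹ * u) (-(C (2 * ε)⁻¹ * v)) * addOmegaMul ε A (-B) = addOmegaMul ε 1 0 := by
    have hadd : ∀ A B A' B' : K[X], addOmegaMul ε A B + addOmegaMul ε A' B' =
        addOmegaMul ε (A + A') (B + B') := fun A B A' B' => by
      simp only [addOmegaMul, Polynomial.map_add]
      ring
    rw [addOmegaMul_mul, addOmegaMul_mul, hadd]
    congr 1
    · have h3 : (C 2⁻¹ : K[X]) * 2 = 1 := by
        rw [← map_ofNat (C : K →+* K[X]) 2, ← C_mul, inv_mul_cancel₀ h2, C_1]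
      have h4 : (C (2 * ε)⁻¹ : K[X]) * C ε * 2 = 1 := by
        rw [← map_ofNat (C : K →+* K[X]) 2, ← C_mul, ← C_mul]
        rw [show (2 * ε)⁻¹ * ε * 2 = 1 by field_simp, C_1]
      linear_combination u * A * h3 + v * B * h4 + huv
    · ring
  rw [quadConj_addOmegaMul]
  refine ⟨_, _, key.trans ?_⟩
  simp [addOmegaMul]

/-- If `f` is represented by `X² - ε Y²` over `K(x)`, then it is so over `K[x]`, compatibly with
the factorisations of `f`. -/
theorem exists_norm_form (h2 : (2 : K) ≠ 0) (hε : ε ≠ 0) {f a b m : K[X]} {n : ℕ} (hf : f.Monic)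
    (hsq : Squarefree f) (hn : f.natDegree = 2 * n) (hb : b ≠ 0)
    (h : f * b ^ 2 = a ^ 2 - C ε * m ^ 2) :
    ∃ h₁ h₂ : K[X], f = h₁ ^ 2 - C ε * h₂ ^ 2 ∧
      ∀ q : K[X], q.Monic → q ∣ f → ∃ A B E G : K[X], q = A ^ 2 - C ε * B ^ 2 ∧
        f = q * (E ^ 2 - C ε * G ^ 2) ∧ h₁ = A * E + C ε * (B * G) ∧ h₂ = A * G + B * E ∧
        (A * E - C ε * (B * G)).Monic ∧ (A * E - C ε * (B * G)).natDegree = n ∧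
        ∀ k, n ≤ k → (A * G - B * E).coeff k = 0 := by
  classical
  have hinj : Function.Injective (Polynomial.map (algebraMap K (QuadraticAlgebra K ε 0))) :=
    map_injective _ (algebraMap K (QuadraticAlgebra K ε 0)).injective
  set d := EuclideanDomain.gcd a m with hd
  have hd0 : d ≠ 0 := by
    intro h0
    obtain ⟨rfl, rfl⟩ := EuclideanDomain.gcd_eq_zero_iff.1 h0
    have : f * b ^ 2 = 0 := by rw [h]; ring
    exact mul_ne_zero hf.ne_zero (pow_ne_zero 2 hb) this
  obtain ⟨a0, ha0⟩ : d ∣ a := EuclideanDomain.gcd_dvd_left a m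
  obtain ⟨m0, hm0⟩ : d ∣ m := EuclideanDomain.gcd_dvd_right a m
  have hcop : IsCoprime a0 m0 := by
    refine ⟨EuclideanDomain.gcdA a m, EuclideanDomain.gcdB a m, ?_⟩
    have h3 := EuclideanDomain.gcd_eq_gcd_ab a m
    rw [← hd] at h3
    refine mul_left_cancel₀ hd0 ?_
    linear_combination -h3 - EuclideanDomain.gcdA a m * ha0 - EuclideanDomain.gcdB a m * hm0
  -- After removing gcd(d, b), the square of what remains of d divides f, so it is a unit because f
  -- is squarefree.
  have hdb : d ∣ b := by
    set c := EuclideanDomain.gcd d b with hc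
    have hc0 : c ≠ 0 := fun h0 => hb (EuclideanDomain.gcd_eq_zero_iff.1 h0).2
    obtain ⟨d1, hd1⟩ : c ∣ d := EuclideanDomain.gcd_dvd_left d b
    obtain ⟨b1, hb1⟩ : c ∣ b := EuclideanDomain.gcd_dvd_right d b
    have hcop1 : IsCoprime d1 b1 := by
      refine ⟨EuclideanDomain.gcdA d b, EuclideanDomain.gcdB d b, ?_⟩
      have h3 := EuclideanDomain.gcd_eq_gcd_ab d b
      rw [← hc] at h3
      refine mul_left_cancel₀ hc0 ?_
      linear_combination -h3 - EuclideanDomain.gcdA d b * hd1 - EuclideanDomain.gcdB d b * hb1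
    have h4 : f * b1 ^ 2 = d1 ^ 2 * (a0 ^ 2 - C ε * m0 ^ 2) := by
      refine mul_left_cancel₀ (pow_ne_zero 2 hc0) ?_
      calc c ^ 2 * (f * b1 ^ 2) = f * (c * b1) ^ 2 := by ring
        _ = (d * a0) ^ 2 - C ε * (d * m0) ^ 2 := by rw [← hb1, h, ← ha0, ← hm0]
        _ = _ := by rw [hd1]; ring
    have h5 : d1 ^ 2 ∣ f := (hcop1.pow (m := 2) (n := 2)).dvd_of_dvd_mul_right ⟨_, h4⟩
    have h6 : IsUnit d1 := hsq d1 (by rwa [← sq])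
    rw [hd1, hb1]
    exact mul_dvd_mul_left c h6.dvd
  obtain ⟨b0, hb0⟩ := hdb
  have h0 : f * b0 ^ 2 = a0 ^ 2 - C ε * m0 ^ 2 := by
    refine mul_left_cancel₀ (pow_ne_zero 2 hd0) ?_
    calc d ^ 2 * (f * b0 ^ 2) = f * (d * b0) ^ 2 := by ring
      _ = (d * a0) ^ 2 - C ε * (d * m0) ^ 2 := by rw [← hb0, h, ← ha0, ← hm0]
      _ = _ := by ring
  have hα := isCoprime_addOmegaMul h2 hε hcop
  -- The whole of f is now a monic divisor of the norm of a₀ + √ε m₀, hence itself the norm of some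
  -- η.
  obtain ⟨η, hηm, hηα, hη⟩ := exists_eq_mul_quadConj hα hf (by
    rw [addOmegaMul_mul_quadConj, ← h0, Polynomial.map_mul]
    exact dvd_mul_right _ _)
  have hηcop : IsCoprime η (quadConj ε η) :=
    (hα.of_isCoprime_of_dvd_left hηα).of_isCoprime_of_dvd_right (_root_.map_dvd _ hηα)
  obtain ⟨h₁, h₂, hh⟩ := exists_eq_addOmegaMul η
  refine ⟨h₁, h₂, ?_, fun q hq hqf => ?_⟩
  · rw [hh, addOmegaMul_mul_quadConj] at hη
    exact hinj hη
  · obtain ⟨δ, hδm, ⟨e, he⟩, hδ⟩ := exists_eq_mul_quadConj hηcop hq (by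
      rw [← hη]
      exact _root_.map_dvd (mapRingHom (algebraMap K (QuadraticAlgebra K ε 0))) hqf)
    have hem : e.Monic := hδm.of_mul_monic_left (he ▸ hηm)
    obtain ⟨A, B, hAB⟩ := exists_eq_addOmegaMul δ
    obtain ⟨E, G, hEG⟩ := exists_eq_addOmegaMul e
    have hprod : h₁ = A * E + C ε * (B * G) ∧ h₂ = A * G + B * E := by
      rw [hh, hAB, hEG, addOmegaMul_mul] at he
      exact addOmegaMul_inj.1 he
    have hqAB : q = A ^ 2 - C ε * B ^ 2 := by
      rw [hAB, addOmegaMul_mul_quadConj] at hδ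
      exact hinj hδ
    have hfq : f = q * (E ^ 2 - C ε * G ^ 2) := by
      rw [hh, addOmegaMul_mul_quadConj] at hη
      rw [hinj hη, hprod.1, hprod.2, hqAB]
      ring
    -- Replacing δ by its conjugate in η = δ e keeps the norm f and the degree n. Monicity of the
    -- product makes its rational part monic of degree n and its √ε part of degree < n.
    have hconj : quadConj ε δ * e = addOmegaMul ε (A * E - C ε * (B * G)) (A * G - B * E) := by
      rw [hAB, hEG, quadConj_addOmegaMul, addOmegaMul_mul]
      congr 1 <;> ring
    have hm : (quadConj ε δ * e).Monic := (monic_quadConj hδm).mul hem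
    have hdeg : (quadConj ε δ * e).natDegree = n := by
      have h3 : (f.map (algebraMap K (QuadraticAlgebra K ε 0))).natDegree = 2 * n := by
        rw [natDegree_map, hn]
      have h4 : ∀ p : (QuadraticAlgebra K ε 0)[X], (quadConj ε p).natDegree = p.natDegree :=
        fun p => natDegree_map _
      rw [hη, hηm.natDegree_mul (monic_quadConj hηm), h4, he, hδm.natDegree_mul hem] at h3
      rw [(monic_quadConj hδm).natDegree_mul hem, h4]
      omega
    rw [hconj] at hm hdeg
    obtain ⟨k1, k2, k3⟩ := monic_and_lt_of_addOmegaMul hm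
    rw [hdeg] at k2 k3
    exact ⟨A, B, E, G, hqAB, hfq, hprod.1, hprod.2, k1, k2, k3⟩

end QuadraticExtension

/-- A nonzero polynomial over a field is a constant times a monic squarefree polynomial times a
square. -/
theorem exists_eq_C_mul_squarefree_mul_sq {K : Type*} [Field K] {p : K[X]} (hp : p ≠ 0) :
    ∃ (c : K) (q s : K[X]), c ≠ 0 ∧ q.Monic ∧ Squarefree q ∧ s ≠ 0 ∧ p = C c * q * s ^ 2 := by
  induction hn : p.natDegree using Nat.strong_induction_on generalizing p with
  | _ n ih =>
    by_cases hsq : Squarefree p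
    · have hl : p.leadingCoeff ≠ 0 := leadingCoeff_ne_zero.2 hp
      have hC : (C p.leadingCoeff : K[X]) * C p.leadingCoeff⁻¹ = 1 := by
        rw [← C_mul, mul_inv_cancel₀ hl, C_1]
      refine ⟨p.leadingCoeff, p * C p.leadingCoeff⁻¹, 1, hl, monic_mul_leadingCoeff_inv hp, ?_,
        one_ne_zero, ?_⟩
      · exact hsq.squarefree_of_dvd ⟨C p.leadingCoeff, by
          linear_combination -p * hC⟩
      · linear_combination -p * hC
    · rw [Squarefree] at hsq
      push Not at hsq
      obtain ⟨x, ⟨p', hp'⟩, hx⟩ := hsq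
      have hx0 : x ≠ 0 := by
        rintro rfl
        rw [zero_mul, zero_mul] at hp'
        exact hp hp'
      have hp0 : p' ≠ 0 := by
        rintro rfl
        rw [mul_zero] at hp'
        exact hp hp'
      have hxd : 0 < x.natDegree := Nat.pos_of_ne_zero fun h => hx
        (isUnit_iff_degree_eq_zero.2 ((degree_eq_iff_natDegree_eq hx0).2 (by exact_mod_cast h)))
      have hdeg : p'.natDegree < n := by
        rw [← hn, hp', natDegree_mul (mul_ne_zero hx0 hx0) hp0, natDegree_mul hx0 hx0]
        omega
      obtain ⟨c, q, s, hc, hq, hqs, hs, h⟩ := ih _ hdeg hp0 rfl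
      exact ⟨c, q, x * s, hc, hq, hqs, mul_ne_zero hx0 hs, by rw [hp', h]; ring⟩

theorem dvd_of_squarefree_of_prime_dvd {K : Type*} [Field K] {q f : K[X]} (hq : Squarefree q)
    (h : ∀ p, Prime p → p ∣ q → p ∣ f) : q ∣ f := by
  classical
  obtain ⟨r, hr⟩ := EuclideanDomain.gcd_dvd_left q f
  have hu : IsUnit r := by
    by_contra hr1
    have hr0 : r ≠ 0 := by
      rintro rfl
      rw [mul_zero] at hr
      exact hq.ne_zero hr
    obtain ⟨p, hp, hpr⟩ := WfDvdMonoid.exists_irreducible_factor hr1 hr0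
    have hpq : p ∣ q := hr ▸ hpr.mul_left _
    have hpg : p ∣ EuclideanDomain.gcd q f := EuclideanDomain.dvd_gcd hpq (h p hp.prime hpq)
    exact hp.not_isUnit (hq p (hr ▸ mul_dvd_mul hpg hpr))
  rw [hr]
  exact (hu.mul_right_dvd).2 (EuclideanDomain.gcd_dvd_right q f)

end Polynomial

namespace HyperellipticCurve

open CurveDivisor

variable {K : Type*} [Field K] {g : ℕ} (C : HyperellipticCurve K g)

/-! ### Functions modulo constants and squares -/

section SquareClasses

theorem exists_ratFunc_eq_squarefree_mul_sq {r : RatFunc K} (hr : r ≠ 0) :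
    ∃ (c : K) (q : K[X]) (s : RatFunc K), c ≠ 0 ∧ q.Monic ∧ Squarefree q ∧ s ≠ 0 ∧
      r = algebraMap K[X] (RatFunc K) (Polynomial.C c * q) * s ^ 2 := by
  obtain ⟨c, q, s, hc, hq, hsq, hs, h⟩ := exists_eq_C_mul_squarefree_mul_sq
    (mul_ne_zero (RatFunc.num_ne_zero hr) r.denom_ne_zero)
  have hd : algebraMap K[X] (RatFunc K) r.denom ≠ 0 := by simpa using r.denom_ne_zero
  have hs' : algebraMap K[X] (RatFunc K) s ≠ 0 := by simpa using hs
  refine ⟨c, q, algebraMap K[X] (RatFunc K) s / algebraMap K[X] (RatFunc K) r.denom, hc, hq, hsq,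
    div_ne_zero hs' hd, ?_⟩
  have h' := congrArg (algebraMap K[X] (RatFunc K)) h
  rw [map_mul, map_mul, map_pow] at h'
  nth_rw 1 [← RatFunc.num_div_denom r]
  rw [div_pow, mul_div_assoc', ← h', sq]
  field_simp

/-- Hilbert 90 for the hyperelliptic involution: a function whose norm is a square is, up to
squares, a squarefree polynomial in `x`. -/
theorem exists_eq_squarefree_mul_sq {v : C.FunctionField} (hv : v ≠ 0) {r : RatFunc K}
    (h : v * C.involution v = (algebraMap _ _ r) ^ 2) :
    ∃ (c : K) (q : K[X]) (z : C.FunctionField), c ≠ 0 ∧ q.Monic ∧ Squarefree q ∧ z ≠ 0 ∧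
      v = algebraMap K[X] _ (Polynomial.C c * q) * z ^ 2 := by
  suffices ∃ (ρ : RatFunc K) (z : C.FunctionField), ρ ≠ 0 ∧ z ≠ 0 ∧ v = algebraMap _ _ ρ * z ^ 2 by
    obtain ⟨ρ, z, hρ, hz, hv⟩ := this
    obtain ⟨c, q, s, hc, hq, hsq, hs, hρ'⟩ := exists_ratFunc_eq_squarefree_mul_sq hρ
    refine ⟨c, q, algebraMap _ _ s * z, hc, hq, hsq, mul_ne_zero (by simpa using hs) hz, ?_⟩
    rw [hv, hρ', map_mul, ← IsScalarTower.algebraMap_apply, map_pow]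
    ring
  have hσ : C.involution v ≠ 0 := by simpa using hv
  have hr : r ≠ 0 := by
    rintro rfl
    rw [map_zero, zero_pow two_ne_zero] at h
    exact mul_ne_zero hv hσ h
  -- The Hilbert 90 element z = v + r must be nonzero; if it vanishes, v = -r already lies in K(x).
  by_cases hneg : v = -algebraMap _ _ r
  · exact ⟨-r, 1, neg_ne_zero.2 hr, one_ne_zero, by rw [map_neg, ← hneg]; ring⟩
  set z := v + algebraMap _ _ r with hz
  have hz0 : z ≠ 0 := fun h0 => hneg (eq_neg_of_add_eq_zero_left h0)
  obtain ⟨a, b, hab⟩ := C.exists_eq_add_mul_y z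
  have hnm := C.mul_involution a b
  rw [← hab] at hnm
  set n := a ^ 2 - b ^ 2 * algebraMap K[X] (RatFunc K) C.f with hn
  have hσz : C.involution z = C.involution v + algebraMap _ _ r := by
    rw [hz, map_add, involution_algebraMap]
  have hn0 : n ≠ 0 := by
    intro h0
    rw [h0, map_zero] at hnm
    exact mul_ne_zero hz0 (by simpa using hz0) hnm
  have hn0' : algebraMap _ C.FunctionField n ≠ 0 := by simpa using hn0
  -- From v·σ(v) = r² one gets v·N(v + r) = r (v + r)².
  refine ⟨r / n, z, div_ne_zero hr hn0, hz0, ?_⟩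
  rw [map_div₀, div_mul_eq_mul_div, eq_div_iff hn0', ← hnm, hσz]
  linear_combination z * h - algebraMap (RatFunc K) C.FunctionField r * z * hz

variable {C}

theorem ord_squarefree {P : CurvePoint K C.FunctionField} (hx : 0 ≤ P.ord C.x) {p q : K[X]}
    (hp : Prime p) (hq : Squarefree q) (hpq : p ∣ q)
    (hP : 0 < P.ord (algebraMap K[X] C.FunctionField p)) :
    P.ord (algebraMap K[X] C.FunctionField q) = P.ord (algebraMap K[X] C.FunctionField p) := by
  obtain ⟨r, rfl⟩ := hpq
  have hr0 : r ≠ 0 := right_ne_zero_of_mul hq.ne_zero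
  have hpr : ¬ p ∣ r := by
    rintro ⟨s, rfl⟩
    exact hp.not_isUnit (hq p ⟨s, by ring⟩)
  rw [map_mul, P.ord_mul (C.polynomial_ne_zero hp.ne_zero) (C.polynomial_ne_zero hr0),
    ord_eq_zero_of_isCoprime P hx (hp.irreducible.coprime_iff_not_dvd.2 hpr) hP hp.ne_zero hr0,
    add_zero]

theorem ord_C_mul_mul_sq (P : CurvePoint K C.FunctionField) {c : K} (hc : c ≠ 0) {q : K[X]}
    (hq : q ≠ 0) {z : C.FunctionField} (hz : z ≠ 0) :
    P.ord (algebraMap K[X] _ (Polynomial.C c * q) * z ^ 2) =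
      P.ord (algebraMap K[X] _ q) + 2 * P.ord z := by
  have hc' : (Polynomial.C c : K[X]) ≠ 0 := by simpa using hc
  rw [P.ord_mul (C.polynomial_ne_zero (mul_ne_zero hc' hq)) (pow_ne_zero 2 hz), P.ord_pow, map_mul,
    P.ord_mul (C.polynomial_ne_zero hc') (C.polynomial_ne_zero hq), ord_C P hc]
  simp

/-- A prime factor of q not dividing f has an unramified place above it, where q has order 1 and the
function odd order. Only finite places matter, so nothing has to be known at infinity. -/
theorem squarefree_dvd_of_even (h2 : (2 : K) ≠ 0) {c : K} (hc : c ≠ 0) {q : K[X]}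
    (hq : Squarefree q) {z : C.FunctionField} (hz : z ≠ 0)
    (h : ∀ P : CurvePoint K C.FunctionField, 0 ≤ P.ord C.x →
      Even (P.ord (algebraMap K[X] _ (Polynomial.C c * q) * z ^ 2))) : q ∣ C.f := by
  refine dvd_of_squarefree_of_prime_dvd hq fun p hp hpq => ?_
  by_contra hpf
  obtain ⟨P, hx, hP⟩ := C.exists_unramified h2 hp hpf
  have h1 := h P hx
  rw [ord_C_mul_mul_sq P hc hq.ne_zero hz, ord_squarefree hx hp hq hpq (by omega), hP] at h1
  obtain ⟨k, hk⟩ := h1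
  omega

/-- A function with even divisor has norm a constant times a square. -/
theorem exists_norm_eq_C_mul_sq (h2 : (2 : K) ≠ 0) {u : C.FunctionField} (hu : u ≠ 0)
    (h : ∀ P : CurvePoint K C.FunctionField, Even (P.ord u)) :
    ∃ (ε : K) (s : RatFunc K), ε ≠ 0 ∧ s ≠ 0 ∧
      u * C.involution u = algebraMap _ _ (algebraMap K (RatFunc K) ε * s ^ 2) := by
  obtain ⟨a, b, hab⟩ := C.exists_eq_add_mul_y u
  have hnm := C.mul_involution a b
  rw [← hab] at hnm
  set n := a ^ 2 - b ^ 2 * algebraMap K[X] (RatFunc K) C.f with hn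
  have hσ : C.involution u ≠ 0 := by simpa using hu
  have hn0 : n ≠ 0 := by
    intro h0
    rw [h0, map_zero] at hnm
    exact mul_ne_zero hu hσ hnm
  obtain ⟨ε, q, s, hε, hq, hsq, hs, hρ⟩ := exists_ratFunc_eq_squarefree_mul_sq hn0
  have hs' : algebraMap _ C.FunctionField s ≠ 0 := by simpa using hs
  have hord : ∀ P : CurvePoint K C.FunctionField, P.ord u + (P.comap C.involution).ord u =
      P.ord (algebraMap K[X] _ q) + 2 * P.ord (algebraMap _ C.FunctionField s) := by
    intro P
    rw [P.ord_comap, ← P.ord_mul hu hσ, hnm, hρ, map_mul, map_pow,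
      ← IsScalarTower.algebraMap_apply, ord_C_mul_mul_sq P hε hq.ne_zero hs']
  have hq1 : q = 1 := by
    by_contra hq1
    have hunit : ¬ IsUnit q := fun hu => hq1 (hq.eq_one_of_isUnit hu)
    obtain ⟨p, hp, hpq⟩ := WfDvdMonoid.exists_irreducible_factor hunit hq.ne_zero
    by_cases hpf : p ∣ C.f
    -- Ramified case, modulo 4: the left side of `hord` is 2·ord(u) with ord(u) even, while the
    -- right side is 2 + 2·ord(s) with ord(s) even.
    · obtain ⟨P, hx, hP, hPσ, hdvd⟩ := C.exists_ramified h2 hp.prime hpf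
      have h1 := hord P
      rw [hPσ, ord_squarefree hx hp.prime hsq hpq (by omega), hP] at h1
      obtain ⟨k, hk⟩ := h P
      obtain ⟨l, hl⟩ := hdvd s
      omega
    -- Unramified case, modulo 2: q has order 1, all other terms are even.
    · obtain ⟨P, hx, hP⟩ := C.exists_unramified h2 hp.prime hpf
      have h1 := hord P
      rw [ord_squarefree hx hp.prime hsq hpq (by omega), hP] at h1
      obtain ⟨k, hk⟩ := h P
      obtain ⟨l, hl⟩ := h (P.comap C.involution)
      omega
  refine ⟨ε, s, hε, hs, ?_⟩
  rw [hnm, hρ, hq1, mul_one, IsScalarTower.algebraMap_apply K K[X] (RatFunc K), algebraMap_eq]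

theorem y_add_polynomial_ne_zero (p : K[X]) : C.y + algebraMap K[X] _ p ≠ 0 := by
  intro h
  have h1 := C.add_mul_y_eq_zero_iff (a := algebraMap K[X] (RatFunc K) p) (b := 1)
  rw [map_one, one_mul, ← IsScalarTower.algebraMap_apply, add_comm, h] at h1
  exact one_ne_zero (h1.1 rfl).2

theorem y_sub_polynomial_ne_zero (p : K[X]) : C.y - algebraMap K[X] _ p ≠ 0 := by
  have := C.y_add_polynomial_ne_zero (-p)
  rwa [map_neg, ← sub_eq_add_neg] at this

end SquareClasses

/-! ### Consequences of a representation f = h₁² - ε h₂² -/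

section NormForm

variable {C}

theorem ne_zero_of_eq_norm {ε : K} {h₁ h₂ : K[X]}
    (h : C.f = h₁ ^ 2 - Polynomial.C ε * h₂ ^ 2) : h₁ ≠ 0 ∧ h₂ ≠ 0 := by
  have key : ∀ p : K[X], p ^ 2 ∣ C.f → C.f ∣ p ^ 2 → False := fun p hp hp' => by
    have h1 : IsUnit p := C.separable.squarefree p (by rwa [← sq])
    have h3 := natDegree_eq_zero_of_isUnit (isUnit_of_dvd_unit hp' (h1.pow 2))
    rw [C.natDegree_eq] at h3
    omega
  constructor
  · rintro rfl
    have hε : ε ≠ 0 := by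
      rintro rfl
      exact C.monic.ne_zero (by rw [h]; simp)
    have h1 : h₂ ^ 2 = C.f * Polynomial.C (-ε⁻¹) := by
      have : (Polynomial.C ε : K[X]) * Polynomial.C ε⁻¹ = 1 := by
        rw [← C_mul, mul_inv_cancel₀ hε, C_1]
      rw [h, C_neg]
      linear_combination -h₂ ^ 2 * this
    exact key h₂ ⟨-Polynomial.C ε, by rw [h]; ring⟩ ⟨_, h1⟩
  · rintro rfl
    exact key h₁ ⟨1, by rw [h]; ring⟩ ⟨1, by rw [h]; ring⟩

theorem isCoprime_of_eq_norm {ε : K} {h₁ h₂ : K[X]}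
    (h : C.f = h₁ ^ 2 - Polynomial.C ε * h₂ ^ 2) : IsCoprime h₁ h₂ := by
  refine isCoprime_of_prime_dvd (fun h0 => (ne_zero_of_eq_norm h).1 h0.1) ?_
  rintro p hp ⟨a, rfl⟩ ⟨b, rfl⟩
  exact hp.not_isUnit (C.separable.squarefree p ⟨a ^ 2 - Polynomial.C ε * b ^ 2, by rw [h]; ring⟩)

/-- The product (y + h₁)(y - h₁) = -ε h₂² has even order. If y + h₁ had odd order, both factors
would vanish at P, hence so would 2h₁; but then h₂, coprime to h₁, has order 0 and the product
cannot vanish. -/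
theorem even_ord_y_add (h2 : (2 : K) ≠ 0) {ε : K} (hε : ε ≠ 0) {h₁ h₂ : K[X]}
    (h : C.f = h₁ ^ 2 - Polynomial.C ε * h₂ ^ 2) {P : CurvePoint K C.FunctionField}
    (hx : 0 ≤ P.ord C.x) : Even (P.ord (C.y + algebraMap K[X] _ h₁)) := by
  obtain ⟨h10, h20⟩ := ne_zero_of_eq_norm h
  have hy : C.y ∈ P.localRing := by
    rw [← P.ord_nonneg_iff C.y_ne_zero]
    have h1 := two_mul_ord_y P
    have h3 := ord_polynomial_nonneg P hx C.monic.ne_zero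
    omega
  have hα0 := C.y_add_polynomial_ne_zero h₁
  have hβ0 := C.y_sub_polynomial_ne_zero h₁
  have hα := (P.ord_nonneg_iff hα0).2 (add_mem hy (polynomial_mem_localRing P hx h₁))
  have hβ := (P.ord_nonneg_iff hβ0).2 (sub_mem hy (polynomial_mem_localRing P hx h₁))
  have hmul : (C.y + algebraMap K[X] _ h₁) * (C.y - algebraMap K[X] _ h₁) =
      algebraMap K[X] _ (Polynomial.C (-ε) * 1) * (algebraMap K[X] _ h₂) ^ 2 := by
    have hy2 := C.y_sq
    rw [h] at hy2
    simp only [map_sub, map_mul, map_pow, map_neg, map_one] at hy2 ⊢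
    linear_combination hy2
  have hsum := congrArg P.ord hmul
  rw [P.ord_mul hα0 hβ0, ord_C_mul_mul_sq P (neg_ne_zero.2 hε) one_ne_zero
    (C.polynomial_ne_zero h20), map_one, P.ord_one, zero_add] at hsum
  by_contra hodd
  have hα1 : 1 ≤ P.ord (C.y + algebraMap K[X] _ h₁) := by
    by_contra hlt
    exact hodd ⟨0, by omega⟩
  have hβ1 : 1 ≤ P.ord (C.y - algebraMap K[X] _ h₁) := by
    by_contra hlt
    exact hodd ⟨P.ord (algebraMap K[X] C.FunctionField h₂), by omega⟩
  have h2' : (Polynomial.C 2 : K[X]) ≠ 0 := by simpa using h2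
  have hdiff : (C.y + algebraMap K[X] _ h₁) + -(C.y - algebraMap K[X] _ h₁) =
      algebraMap K[X] _ (Polynomial.C 2 * h₁) := by
    rw [map_mul, map_ofNat, map_ofNat]
    ring
  have hle := P.le_ord_add hα1 (v := -(C.y - algebraMap K[X] _ h₁)) (by rwa [P.ord_neg]) hα0
    (neg_ne_zero.2 hβ0) (by rw [hdiff]; exact C.polynomial_ne_zero (mul_ne_zero h2' h10))
  rw [hdiff, map_mul, P.ord_mul (C.polynomial_ne_zero h2') (C.polynomial_ne_zero h10),
    ord_C P h2, zero_add] at hle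
  have h3 := ord_eq_zero_of_isCoprime P hx (isCoprime_of_eq_norm h) (by omega) h10 h20
  omega

/-- With h₁ = x^(g+1) + r, only the cross term 2 r x^(g+1) reaches degree 2g + 1, as r² and h₂² have
degree ≤ 2g. -/
theorem coeff_of_eq_norm (h2 : (2 : K) ≠ 0) {ε : K} {h₁ h₂ : K[X]} (hm : h₁.Monic)
    (hd₁ : h₁.natDegree = g + 1) (hd₂ : h₂.natDegree ≤ g)
    (h : C.f = h₁ ^ 2 - Polynomial.C ε * h₂ ^ 2) :
    h₁.coeff g = C.f.coeff (2 * g + 1) / 2 := by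
  set r := h₁ - X ^ (g + 1) with hr
  have hrd : r.natDegree ≤ g := by
    rw [natDegree_le_iff_coeff_eq_zero]
    intro k hk
    rw [hr, coeff_sub, coeff_X_pow]
    split_ifs with hkg
    · rw [hkg, ← hd₁, hm.coeff_natDegree, sub_self]
    · rw [coeff_eq_zero_of_natDegree_lt (by omega), sub_zero]
  have hsq : ∀ p : K[X], p.natDegree ≤ g → (p ^ 2).coeff (2 * g + 1) = 0 := fun p hp =>
    coeff_eq_zero_of_natDegree_lt (by
      have := natDegree_pow_le (p := p) (n := 2)
      omega)
  have hf : C.f = X ^ (2 * g + 2) + Polynomial.C 2 * r * X ^ (g + 1) + r ^ 2 -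
      Polynomial.C ε * h₂ ^ 2 := by
    rw [h, hr, map_ofNat]
    ring
  have h3 : C.f.coeff (2 * g + 1) = 2 * h₁.coeff g := by
    rw [hf, coeff_sub, coeff_add, coeff_add, coeff_C_mul, hsq _ hd₂, hsq _ hrd, coeff_X_pow,
      if_neg (by omega), show 2 * g + 1 = g + (g + 1) by ring, coeff_mul_X_pow, coeff_C_mul, hr,
      coeff_sub, coeff_X_pow, if_neg (by omega)]
    ring
  rw [h3]
  field_simp

end NormForm

/-! ### Special representatives of functions with even divisor -/

section Representatives

variable {C}

/-- The functions allowed in the description of the two-torsion. -/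
def IsSpecial (C : HyperellipticCurve K g) (T : C.FunctionField) : Prop :=
  (∃ h : K[X], Even h.natDegree ∧ h.natDegree ≤ g - 1 ∧ h ∣ C.f ∧ T = C.polyFun h) ∨
  ∃ (h₁ h₂ : K[X]) (a : K), h₁.natDegree = g + 1 ∧ h₁.Monic ∧
    h₁.coeff g = C.f.coeff (2 * g + 1) / 2 ∧ h₂.natDegree ≤ g ∧ a ≠ 0 ∧
    C.f = h₁ ^ 2 - Polynomial.C a * h₂ ^ 2 ∧ T = C.y - C.polyFun h₁

theorem isSpecial_y_sub (h2 : (2 : K) ≠ 0) {a : K} (ha : a ≠ 0) {h₁ h₂ : K[X]} (hm : h₁.Monic)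
    (hd₁ : h₁.natDegree = g + 1) (hd₂ : h₂.natDegree ≤ g)
    (h : C.f = h₁ ^ 2 - Polynomial.C a * h₂ ^ 2) :
    C.IsSpecial (C.y - algebraMap K[X] _ h₁) :=
  Or.inr ⟨h₁, h₂, a, hd₁, hm, coeff_of_eq_norm h2 hm hd₁ hd₂ h, hd₂, ha, h, rfl⟩

/-- Square-norm case: the function is a divisor of f modulo constants and squares. Degree ≤ g - 1
gives form (i), degree g + 1 gives form (ii) with a = 1. -/
theorem exists_special_of_norm_sq (h2 : (2 : K) ≠ 0) (hodd : Odd g) {u : C.FunctionField}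
    (hu : u ≠ 0) (heven : ∀ P : CurvePoint K C.FunctionField, Even (P.ord u)) {r : RatFunc K}
    (h : u * C.involution u = (algebraMap _ _ r) ^ 2) :
    ∃ (κ : K) (w T : C.FunctionField), κ ≠ 0 ∧ w ≠ 0 ∧ C.IsSpecial T ∧
      u * w ^ 2 = algebraMap K _ κ * T := by
  obtain ⟨c, q, z, hc, hq, hsq, hz, huz⟩ := C.exists_eq_squarefree_mul_sq hu h
  have hqf : q ∣ C.f := squarefree_dvd_of_even h2 hc hsq hz fun P _ => huz ▸ heven P
  -- At a place with ord(x) = -1 the order of q is -deg q, and it must be even.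
  have hqeven : Even q.natDegree := by
    obtain ⟨P, hP⟩ := C.exists_infinite h2
    have h1 := heven P
    rw [huz, ord_C_mul_mul_sq P hc hq.ne_zero hz,
      ord_polynomial_of_neg P (by omega) hq.ne_zero, hP] at h1
    obtain ⟨k, hk⟩ := h1
    have h3 : Even (q.natDegree : ℤ) := ⟨P.ord z - k, by omega⟩
    exact_mod_cast h3
  obtain ⟨q', hq'⟩ := hqf
  have hqm' : q'.Monic := hq.of_mul_monic_left (hq' ▸ C.monic)
  have hdeg : q.natDegree + q'.natDegree = 2 * g + 2 := by
    rw [← C.natDegree_eq, hq', hq.natDegree_mul hqm']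
  have hq0 := C.polynomial_ne_zero hq.ne_zero
  obtain ⟨p, p', w, hp, hp', hpp, hpe, hpd, hw, huw⟩ : ∃ (p p' : K[X]) (w : C.FunctionField),
      p.Monic ∧ p'.Monic ∧ C.f = p * p' ∧ Even p.natDegree ∧ p.natDegree ≤ g + 1 ∧ w ≠ 0 ∧
      u * w ^ 2 = algebraMap K _ c * algebraMap K[X] _ p := by
    have huz' : u * z⁻¹ ^ 2 = algebraMap K _ c * algebraMap K[X] _ q := by
      rw [huz, map_mul, algebraMap_C]
      field_simp
    by_cases hle : q.natDegree ≤ g + 1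
    · exact ⟨q, q', z⁻¹, hq, hqm', hq', hqeven, hle, inv_ne_zero hz, huz'⟩
    -- Multiplying by (y/q)² = f/q² exchanges q for the complementary factor f/q.
    · refine ⟨q', q, z⁻¹ * (C.y / algebraMap K[X] _ q), hqm', hq, by rw [hq', mul_comm], ?_,
        by omega, mul_ne_zero (inv_ne_zero hz) (div_ne_zero C.y_ne_zero hq0), ?_⟩
      · obtain ⟨k, hk⟩ := hqeven
        exact ⟨g + 1 - k, by omega⟩
      · rw [mul_pow, ← mul_assoc, huz', div_pow, C.y_sq, hq', map_mul]
        field_simp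
  by_cases hlt : p.natDegree = g + 1
  · set h₁ := Polynomial.C 2⁻¹ * (p + p') with hh₁
    set h₂ := Polynomial.C 2⁻¹ * (p - p') with hh₂
    have hC2 : (Polynomial.C 2⁻¹ : K[X]) * 2 = 1 := by
      rw [← map_ofNat (Polynomial.C : K →+* K[X]) 2, ← C_mul, inv_mul_cancel₀ h2, C_1]
    have hdeg' : p'.natDegree = g + 1 := by
      have h1 := C.natDegree_eq
      rw [hpp, hp.natDegree_mul hp'] at h1
      omega
    have hpc : p.coeff (g + 1) = 1 := hlt ▸ hp.coeff_natDegree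
    have hpc' : p'.coeff (g + 1) = 1 := hdeg' ▸ hp'.coeff_natDegree
    have hd₁ : h₁.natDegree ≤ g + 1 := (natDegree_C_mul_le _ _).trans
      ((natDegree_add_le _ _).trans (by rw [hlt, hdeg', max_self]))
    have hc₁ : h₁.coeff (g + 1) = 1 := by
      rw [hh₁, coeff_C_mul, coeff_add, hpc, hpc', one_add_one_eq_two, inv_mul_cancel₀ h2]
    have hm₁ : h₁.Monic := monic_of_natDegree_le_of_coeff_eq_one _ hd₁ hc₁
    have hd₁' : h₁.natDegree = g + 1 :=
      natDegree_eq_of_le_of_coeff_ne_zero hd₁ (by rw [hc₁]; exact one_ne_zero)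
    have hd₂ : h₂.natDegree ≤ g := by
      rw [natDegree_le_iff_coeff_eq_zero]
      intro k hk
      rw [hh₂, coeff_C_mul, coeff_sub]
      rcases eq_or_ne k (g + 1) with rfl | hkg
      · rw [hpc, hpc', sub_self, mul_zero]
      · rw [coeff_eq_zero_of_natDegree_lt (p := p) (by omega),
          coeff_eq_zero_of_natDegree_lt (p := p') (by omega), sub_self, mul_zero]
    have hf : C.f = h₁ ^ 2 - Polynomial.C 1 * h₂ ^ 2 := by
      rw [hpp, hh₁, hh₂, C_1]
      linear_combination -(p * p') * (Polynomial.C 2⁻¹ * 2 + 1) * hC2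
    have hT0 := C.y_sub_polynomial_ne_zero h₁
    have hp0 := C.y_sub_polynomial_ne_zero p
    refine ⟨-c / 2, w * ((C.y - algebraMap K[X] _ h₁) / (C.y - algebraMap K[X] _ p)), _,
      div_ne_zero (neg_ne_zero.2 hc) h2, mul_ne_zero hw (div_ne_zero hT0 hp0),
      isSpecial_y_sub h2 one_ne_zero hm₁ hd₁' hd₂ hf, ?_⟩
    have h2F : (2 : C.FunctionField) ≠ 0 := by
      rw [← map_ofNat (algebraMap K C.FunctionField) 2]
      exact (_root_.map_ne_zero _).2 h2
    -- Since y² = p p', expanding gives p(p + p' - 2y), which makes p and y - h₁ equal up to the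
    -- constant -2 and squares.
    have hkey : (C.y - algebraMap K[X] _ p) ^ 2 =
        -2 * (C.y - algebraMap K[X] _ h₁) * algebraMap K[X] _ p := by
      have hy := C.y_sq
      rw [hpp, map_mul] at hy
      have hh : 2 * algebraMap K[X] C.FunctionField h₁ =
          algebraMap K[X] _ p + algebraMap K[X] _ p' := by
        rw [← map_ofNat (algebraMap K[X] C.FunctionField) 2, ← map_mul, ← map_add]
        congr 1
        rw [hh₁]
        linear_combination (p + p') * hC2
      linear_combination hy - algebraMap K[X] C.FunctionField p * hh
    rw [mul_pow, ← mul_assoc, huw, div_pow, hkey, map_div₀, map_neg, map_ofNat]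
    have hp0' := C.polynomial_ne_zero hp.ne_zero
    field_simp
  · refine ⟨c, w, C.polyFun p, hc, hw, Or.inl ⟨p, hpe, ?_, ⟨p', hpp⟩, rfl⟩, huw⟩
    obtain ⟨k, hk⟩ := hpe
    obtain ⟨l, hl⟩ := hodd
    omega

theorem exists_mul_sq_eq_polynomial (u : C.FunctionField) :
    ∃ d a b : K[X], d ≠ 0 ∧ u * algebraMap K[X] _ d ^ 2 =
      algebraMap K[X] _ a + algebraMap K[X] _ b * C.y := by
  obtain ⟨a, b, hab⟩ := C.exists_eq_add_mul_y u
  refine ⟨a.denom * b.denom, a.num * a.denom * b.denom ^ 2, b.num * b.denom * a.denom ^ 2,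
    mul_ne_zero a.denom_ne_zero b.denom_ne_zero, ?_⟩
  have ha : algebraMap (RatFunc K) C.FunctionField a * algebraMap K[X] _ a.denom =
      algebraMap K[X] _ a.num := by
    rw [IsScalarTower.algebraMap_apply K[X] (RatFunc K), ← map_mul,
      IsScalarTower.algebraMap_apply K[X] (RatFunc K) C.FunctionField a.num]
    congr 1
    rw [← eq_div_iff (by simpa using a.denom_ne_zero), RatFunc.num_div_denom]
  have hb : algebraMap (RatFunc K) C.FunctionField b * algebraMap K[X] _ b.denom =
      algebraMap K[X] _ b.num := by
    rw [IsScalarTower.algebraMap_apply K[X] (RatFunc K), ← map_mul,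
      IsScalarTower.algebraMap_apply K[X] (RatFunc K) C.FunctionField b.num]
    congr 1
    rw [← eq_div_iff (by simpa using b.denom_ne_zero), RatFunc.num_div_denom]
  rw [hab]
  simp only [map_mul, map_pow]
  rw [← ha, ← hb]
  ring

/-- Nonsquare case: multiplying by y + h₁, where f = h₁² - ε h₂², reduces to square norm. The
polynomial factor q that appears is absorbed by passing to another representation of f. The parity
of g plays no role here. -/
theorem exists_special_of_norm_nonsquare (h2 : (2 : K) ≠ 0) {u : C.FunctionField}
    (hu : u ≠ 0) (heven : ∀ P : CurvePoint K C.FunctionField, Even (P.ord u)) {ε : K}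
    (hε : ∀ r : K, r ^ 2 ≠ ε) {s : RatFunc K} (hs : s ≠ 0)
    (h : u * C.involution u = algebraMap _ _ (algebraMap K (RatFunc K) ε * s ^ 2)) :
    ∃ (κ : K) (w T : C.FunctionField), κ ≠ 0 ∧ w ≠ 0 ∧ C.IsSpecial T ∧
      u * w ^ 2 = algebraMap K _ κ * T := by
  have hε0 : ε ≠ 0 := by
    rintro rfl
    exact hε 0 (by simp)
  -- This instance makes `QuadraticAlgebra K ε 0` a field, namely K(√ε).
  have : Fact (∀ r : K, r ^ 2 ≠ ε + 0 * r) := ⟨fun r => by simpa using hε r⟩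
  obtain ⟨d, a, b, hd, hdab⟩ := C.exists_mul_sq_eq_polynomial u
  have hd0 := C.polynomial_ne_zero hd
  set u' := u * algebraMap K[X] _ d ^ 2 with hu'
  have hu0' : u' ≠ 0 := mul_ne_zero hu (pow_ne_zero 2 hd0)
  have hnorm : algebraMap K[X] (RatFunc K) (a ^ 2 - b ^ 2 * C.f) =
      algebraMap K[X] (RatFunc K) (Polynomial.C ε) * (s * algebraMap K[X] _ d ^ 2) ^ 2 := by
    apply (algebraMap (RatFunc K) C.FunctionField).injective
    have h1 := C.mul_involution (algebraMap K[X] _ a) (algebraMap K[X] _ b)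
    rw [← IsScalarTower.algebraMap_apply, ← IsScalarTower.algebraMap_apply, ← hdab, hu', map_mul,
      map_pow, involution_polynomial] at h1
    rw [map_sub, map_mul, map_pow, map_pow, ← h1, map_mul, map_pow, map_mul, map_pow,
      ← IsScalarTower.algebraMap_apply, ← IsScalarTower.algebraMap_apply, algebraMap_C]
    rw [map_mul, map_pow, ← IsScalarTower.algebraMap_apply] at h
    linear_combination algebraMap K[X] C.FunctionField d ^ 4 * h
  obtain ⟨m, hm⟩ : ∃ m : K[X], algebraMap K[X] (RatFunc K) m = s * algebraMap K[X] _ d ^ 2 := by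
    refine IsIntegrallyClosed.isIntegral_iff.1 (IsIntegral.of_pow (n := 2) two_pos ?_)
    have h1 : (s * algebraMap K[X] (RatFunc K) d ^ 2) ^ 2 =
        algebraMap K[X] (RatFunc K) (Polynomial.C ε⁻¹ * (a ^ 2 - b ^ 2 * C.f)) := by
      rw [map_mul, hnorm, ← mul_assoc, ← map_mul, ← C_mul, inv_mul_cancel₀ hε0, C_1, map_one,
        one_mul]
    rw [h1]
    exact isIntegral_algebraMap
  rw [← hm, ← map_pow, ← map_mul] at hnorm
  have hnorm' : a ^ 2 - b ^ 2 * C.f = Polynomial.C ε * m ^ 2 :=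
    RatFunc.algebraMap_injective K hnorm
  have hm0 : m ≠ 0 := by
    rintro rfl
    rw [map_zero] at hm
    exact mul_ne_zero hs (pow_ne_zero 2 (by simpa using hd)) hm.symm
  -- If b = 0 then a² = ε m², and comparing leading coefficients makes ε a square in K.
  have hb : b ≠ 0 := by
    rintro rfl
    have h1 := congrArg leadingCoeff hnorm'
    rw [zero_pow two_ne_zero, zero_mul, sub_zero, leadingCoeff_mul, leadingCoeff_pow,
      leadingCoeff_pow, leadingCoeff_C] at h1
    have h3 : m.leadingCoeff ≠ 0 := leadingCoeff_ne_zero.2 hm0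
    exact hε (a.leadingCoeff / m.leadingCoeff) (by rw [div_pow, h1]; field_simp)
  obtain ⟨h₁, h₂, hf, hfac⟩ := exists_norm_form h2 hε0 C.monic C.separable.squarefree
    (n := g + 1) (by rw [C.natDegree_eq]; ring) hb (a := a) (m := m) (by
      linear_combination -hnorm')
  have hY0 := C.y_add_polynomial_ne_zero h₁
  set v := u' * (C.y + algebraMap K[X] _ h₁) with hv
  have hv0 : v ≠ 0 := mul_ne_zero hu0' hY0
  have hvn : v * C.involution v =
      (algebraMap (RatFunc K) _ (algebraMap K[X] _ (Polynomial.C ε * m * h₂))) ^ 2 := by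
    have h1 := C.mul_involution (algebraMap K[X] _ a) (algebraMap K[X] _ b)
    rw [← IsScalarTower.algebraMap_apply, ← IsScalarTower.algebraMap_apply, ← hdab, ← map_pow,
      ← map_pow, ← map_mul, ← map_sub, hnorm', ← IsScalarTower.algebraMap_apply] at h1
    have hy2 := C.y_sq
    rw [hf] at hy2
    rw [hv, map_mul, map_add, involution_y, involution_polynomial,
      ← IsScalarTower.algebraMap_apply]
    simp only [map_mul, map_sub, map_pow] at h1 hy2 ⊢
    linear_combination ((algebraMap K[X] C.FunctionField h₁) ^ 2 - C.y ^ 2) * h1 -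
      algebraMap K[X] C.FunctionField (Polynomial.C ε) * algebraMap K[X] C.FunctionField m ^ 2 * hy2
  obtain ⟨c, q, z, hc, hq, hsq, hz, hvz⟩ := C.exists_eq_squarefree_mul_sq hv0 hvn
  have hqf : q ∣ C.f := squarefree_dvd_of_even h2 hc hsq hz fun P hx => by
    rw [← hvz, hv, P.ord_mul hu0' hY0, hu', P.ord_mul hu (pow_ne_zero 2 hd0), P.ord_pow]
    exact ((heven P).add (by simp)).add (even_ord_y_add h2 hε0 hf hx)
  obtain ⟨A, B, E, G, hqAB, hfq, hh₁, hh₂, hm₁, hd₁, hB⟩ := hfac q hq hqf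
  set k₁ := A * E - Polynomial.C ε * (B * G) with hk₁
  set k₂ := A * G - B * E with hk₂
  have hfk : C.f = k₁ ^ 2 - Polynomial.C ε * k₂ ^ 2 := by
    rw [hfq, hk₁, hk₂, hqAB]
    ring
  have hd₂ : k₂.natDegree ≤ g := natDegree_le_iff_coeff_eq_zero.2 fun k hk => hB k hk
  have hk₂0 := C.polynomial_ne_zero (ne_zero_of_eq_norm hfk).2
  -- Formally 2(y + h₁) = (√η + √η̄)² and 2(y + k₁) = (√(δ̄e) + √(δē))². Multiplying the two roots
  -- by √q = √(δδ̄) and halving gives q E + A y, a square root of q(y + h₁)(y + k₁).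
  set S := algebraMap K[X] C.FunctionField q * algebraMap K[X] _ E + algebraMap K[X] _ A * C.y
    with hS
  have hSsq : S ^ 2 = algebraMap K[X] _ q * (C.y + algebraMap K[X] _ h₁) *
      (C.y + algebraMap K[X] _ k₁) := by
    have hy2 := C.y_sq
    have hA : algebraMap K[X] C.FunctionField A ^ 2 = algebraMap K[X] _ q +
        algebraMap K[X] _ (Polynomial.C ε) * algebraMap K[X] _ B ^ 2 := by
      simp only [← map_mul, ← map_pow, ← map_add]
      congr 1
      rw [hqAB]; ring
    rw [hfq] at hy2
    rw [hS, hh₁, hk₁]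
    simp only [map_mul, map_sub, map_add, map_pow] at hy2 ⊢
    linear_combination (algebraMap K[X] C.FunctionField A ^ 2 - algebraMap K[X] C.FunctionField q)
      * hy2 - algebraMap K[X] C.FunctionField q *
      algebraMap K[X] C.FunctionField (Polynomial.C ε) *
      algebraMap K[X] C.FunctionField G ^ 2 * hA
  have hS0 : S ≠ 0 := by
    intro h0
    rw [h0, zero_pow two_ne_zero] at hSsq
    exact mul_ne_zero (mul_ne_zero (C.polynomial_ne_zero hq.ne_zero) hY0)
      (C.y_add_polynomial_ne_zero k₁) hSsq.symm
  -- By `hvz` and `hSsq`, u times the square of this function is c k₂²/(y + k₁); this is -(c/ε)(y -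
  -- k₁), because (y + k₁)(y - k₁) = -ε k₂².
  refine ⟨-c / ε, algebraMap K[X] _ d * (C.y + algebraMap K[X] _ h₁) * algebraMap K[X] _ k₂ /
    (z * S), _, div_ne_zero (neg_ne_zero.2 hc) hε0,
    div_ne_zero (mul_ne_zero (mul_ne_zero hd0 hY0) hk₂0) (mul_ne_zero hz hS0),
    isSpecial_y_sub h2 hε0 hm₁ hd₁ hd₂ hfk, ?_⟩
  have hεF : algebraMap K C.FunctionField ε ≠ 0 := (_root_.map_ne_zero _).2 hε0
  rw [div_pow, mul_div_assoc', div_eq_iff (pow_ne_zero 2 (mul_ne_zero hz hS0)), map_div₀, map_neg,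
    div_mul_eq_mul_div, div_mul_eq_mul_div, eq_div_iff hεF, mul_pow z S, hSsq]
  rw [hv, map_mul, algebraMap_C, hu'] at hvz
  have hy2 := C.y_sq
  rw [hfk] at hy2
  simp only [map_mul, map_sub, map_pow, algebraMap_C] at hy2
  linear_combination (algebraMap K C.FunctionField ε * (C.y + algebraMap K[X] _ h₁) *
    algebraMap K[X] _ k₂ ^ 2) * hvz + algebraMap K C.FunctionField c * z ^ 2 *
    algebraMap K[X] _ q * (C.y + algebraMap K[X] _ h₁) * hy2

/-- A function with even divisor is, up to constants and squares, one of the special functions. -/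
theorem exists_special (h2 : (2 : K) ≠ 0) (hodd : Odd g) {u : C.FunctionField}
    (hu : u ≠ 0) (heven : ∀ P : CurvePoint K C.FunctionField, Even (P.ord u)) :
    ∃ (κ : K) (w T : C.FunctionField), κ ≠ 0 ∧ w ≠ 0 ∧ C.IsSpecial T ∧
      u * w ^ 2 = algebraMap K _ κ * T := by
  obtain ⟨ε, s, hε, hs, h⟩ := C.exists_norm_eq_C_mul_sq h2 hu heven
  by_cases hsq : ∃ r : K, r ^ 2 = ε
  · obtain ⟨r, rfl⟩ := hsq
    refine exists_special_of_norm_sq h2 hodd hu heven (r := algebraMap K (RatFunc K) r * s) ?_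
    rw [h, ← map_pow, mul_pow, map_pow (algebraMap K (RatFunc K))]
  · push Not at hsq
    exact exists_special_of_norm_nonsquare h2 hu heven hsq hs h

end Representatives

end HyperellipticCurve

end

/-! ### The description of two-torsion classes -/

theorem lemma4 {K : Type*} [Field K] (hK : ringChar K ≠ 2) (g : ℕ) (hg : 3 ≤ g) (hodd : Odd g)
    (C : HyperellipticCurve K g) (c : C.JacobianPoints) (hc : addOrderOf c = 2) :
    ∃ D : CurveDivisor.degreeZero K C.FunctionField,
      (QuotientAddGroup.mk D : C.JacobianPoints) = c ∧
      ((∃ h : K[X], Even h.natDegree ∧ h.natDegree ≤ g - 1 ∧ h ∣ C.f ∧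
          CurveDivisor.IsDivOf (2 • (D : CurveDivisor K C.FunctionField)) (C.polyFun h)) ∨
       (∃ (h₁ h₂ : K[X]) (a : K),
          h₁.natDegree = g + 1 ∧ h₁.Monic ∧ h₁.coeff g = C.f.coeff (2 * g + 1) / 2 ∧
          h₂.natDegree ≤ g ∧ a ≠ 0 ∧
          C.f = h₁ ^ 2 - Polynomial.C a * h₂ ^ 2 ∧
          CurveDivisor.IsDivOf (2 • (D : CurveDivisor K C.FunctionField))
            (C.y - C.polyFun h₁))) := by
  have h2 : (2 : K) ≠ 0 := Ring.two_ne_zero hK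
  obtain ⟨D₀, rfl⟩ := QuotientAddGroup.mk_surjective c
  obtain ⟨u, hu, hdiv⟩ : ∃ u : C.FunctionField,
      CurveDivisor.IsDivOf (2 • (D₀ : CurveDivisor K C.FunctionField)) u := by
    have h1 := addOrderOf_nsmul_eq_zero (QuotientAddGroup.mk D₀ : C.JacobianPoints)
    rw [hc, ← QuotientAddGroup.mk_nsmul, QuotientAddGroup.eq_zero_iff,
      AddSubgroup.mem_addSubgroupOf] at h1
    exact h1
  obtain ⟨κ, w, T, hκ, hw, hT, hwT⟩ := HyperellipticCurve.exists_special h2 hodd hu fun P => by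
    rw [← hdiv]
    exact ⟨(D₀ : CurveDivisor K C.FunctionField) P, by
      rw [Finsupp.smul_apply, two_nsmul]⟩
  have hT0 : T ≠ 0 := by
    rintro rfl
    rw [mul_zero] at hwT
    exact mul_ne_zero hu (pow_ne_zero 2 hw) hwT
  -- Adding div(w) to D₀ keeps the class and turns div(u) into div(u w²) = div(T), as constants have
  -- order 0 everywhere.
  obtain ⟨W, ⟨-, hW⟩, hW0⟩ := C.hasDegreeZeroDiv h2 hw
  let W' : CurveDivisor.degreeZero K C.FunctionField := ⟨W, hW0⟩
  have hD : CurveDivisor.IsDivOf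
      (2 • ((D₀ + W' : CurveDivisor.degreeZero K C.FunctionField) :
        CurveDivisor K C.FunctionField)) T := by
    refine ⟨hT0, fun P => ?_⟩
    have h1 := congrArg P.ord hwT
    rw [P.ord_mul hu (pow_ne_zero 2 hw), P.ord_pow, P.ord_mul ((_root_.map_ne_zero _).2 hκ) hT0,
      P.ord_algebraMap hκ, ← hdiv, ← hW, zero_add] at h1
    rw [← h1, AddSubgroup.coe_add, smul_add, Finsupp.add_apply]
    simp [W']
  refine ⟨D₀ + W', ?_, ?_⟩
  · rw [QuotientAddGroup.mk_add, add_eq_left, QuotientAddGroup.eq_zero_iff,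
      AddSubgroup.mem_addSubgroupOf]
    exact ⟨w, hw, hW⟩
  · rcases hT with ⟨h, h1, h3, h4, rfl⟩ | ⟨h₁, h₂, a, h1, h3, h4, h5, h6, h7, rfl⟩
    · exact Or.inl ⟨h, h1, h3, h4, hD⟩
    · exact Or.inr ⟨h₁, h₂, a, h1, h3, h4, h5, h6, h7, hD⟩
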